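/- Setting. Let $G$ be a finite group with an injective matrix product unitary (MPU) representation $g\mapsto U_g$ on spin chains ($U_gU_h=U_{gh}$, $U_e=\mathbb 1$, unitary for every length), with tensors $T_g$, and let $\{|\psi_x\rangle\}_{x\in\mathcal I}$ be injective MPS with tensors $A_x$, pairwise orthogonal in the thermodynamic limit and permuted transitively: $U_g|\psi_x\rangle=|\psi_{gx}\rangle$. Write $T\cdot A$ for the tensor obtained by applying an operator tensor $T$ to the physical leg of $A$. Fusion tensors $(V_{g,h},\widehat V_{g,h})$ and action tensors $(W_{g,x},\widehat W_{g,x})$ are pairs (right, left) of virtual tensors which reduce $T_gT_h$ to $T_{gh}$, respectively $T_g\cdot A_x$ to $A_{gx}$. Here $(Q,P)$ reduces $B$ to $A$ if $PB^{i_1}\cdots B^{i_m}Q=A^{i_1}\cdots A^{i_m}$ for all $m\ge 0$ and $B^iQA^{j_1}\cdots A^{j_m}PB^k=B^iB^{j_1}\cdots B^{j_m}B^k$ for all $m\ge1$. Fix such tensors. The $L$-symbols are the non-zero numbers $L^x_{g,h}$ for which, with $M=T_g\cdot(T_h\cdot A_x)$, $$M^iM^jM^k\,(V_{g,h}\otimes\mathbb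 1)W_{gh,x}=L^x_{g,h}\;M^iM^jM^k\,(\mathbb 1\otimes W_{h,x})W_{g,hx}\quad\text{for all } i,j,k .$$ Let $e_{xy}$ ($x,y\in\mathcal I$) be non-zero tensors such that the states $|\psi(x,y)\rangle$ with coefficients $\mathrm{Tr}[e_{xy}A_y\cdots A_y\,e_{yx}A_x\cdots A_x]$ satisfy $U_g|\psi(x,y)\rangle\propto|\psi(gx,gy)\rangle$ whenever the two walls are far enough apart. The $B$-phases are the non-zero numbers $B^g_{x,y}$ with $$\widehat W_{g,x}\,(T_g\cdot A_x)^i\,(T_g\cdot e_{xy})^j\,(T_g\cdot A_y)^k\,W_{g,y}=B^g_{x,y}\;A_{gx}^i\,e_{gx,gy}^j\,A_{gy}^k\quad\text{for all } i,j,k .$$ Let $H=\{h\in G: hx=x\ \text{for all}\ x\in\mathcal I\}$ be the unbroken subgroup. Statement. The $L$-symbols exist and are unique, and, for every such family $e$, so are the $B$-phases. For all $x,y\in\mathcal I$ and $h_1,h_2,h_3\in H$: 1. $\displaystyle B^{h_1}_{y,x}B^{h_2}_{y,x}=\frac{L^y_{h_1,h_2}}{L^x_{h_1,h_2}}\,B^{h_1h_2}_{y,x}$.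 2. The factor is a 2-cocycle on $H$ (with no reference to the tensors $e$): $$\frac{L^y_{h_1,h_2}}{L^x_{h_1,h_2}}\frac{L^y_{h_1h_2,h_3}}{L^x_{h_1h_2,h_3}}=\frac{L^y_{h_1,h_2h_3}}{L^x_{h_1,h_2h_3}}\frac{L^y_{h_2,h_3}}{L^x_{h_2,h_3}} .$$ 3. Rescaling $V_{g,h}\to\beta_{g,h}V_{g,h}$, $\widehat V_{g,h}\to\beta_{g,h}^{-1}\widehat V_{g,h}$, $W_{g,x}\to\gamma_{g,x}W_{g,x}$, $\widehat W_{g,x}\to\gamma_{g,x}^{-1}\widehat W_{g,x}$ with non-zero numbers again gives fusion and action tensors, and it divides the factor by the coboundary $\frac{(\gamma_{h_1,y}/\gamma_{h_1,x})(\gamma_{h_2,y}/\gamma_{h_2,x})}{\gamma_{h_1h_2,y}/\gamma_{h_1h_2,x}}$. One can rescale so that all $L$-symbols have modulus one; whenever they do, $|B^h_{y,x}|=1$ for all $h\in H$. 4. Local excitations transform linearly: $B^{h_1}_{x,x}B^{h_2}_{x,x}=B^{h_1h_2}_{x,x}$. 5. The unbroken symmetry can act genuinely projectively on domain walls: there are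 such a group, MPUs, MPS, fusion and action tensors with $L$-symbols of modulus one, and $x,y\in\mathcal I$, for which linear maps $R_h$ ($h\in H$) on the space of all tensors $e$ between $y$ and $x$ satisfy $\widehat W_{h,y}(T_h\cdot A_y)^i(T_h\cdot e)^j(T_h\cdot A_x)^kW_{h,x}=A_y^i\,(R_he)^j\,A_x^k$ for all $i,j,k$, and $R_{h_1}R_{h_2}=\frac{L^y_{h_1,h_2}}{L^x_{h_1,h_2}}R_{h_1h_2}$, where the factor is not a 2-coboundary $H\times H\to\mathbb C^\times$. -/

import Mathlib

open scoped Kronecker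
open Filter Topology

namespace DomainWall

/-- The ordered product of the matrices of a tensor along a finite string of physical indices. -/
noncomputable def word {κ m : Type*} [Fintype m] [DecidableEq m]
    (A : κ → Matrix m m ℂ) (l : List κ) : Matrix m m ℂ :=
  (l.map A).prod

/-- A tensor is injective when, read as a map from the virtual to the physical space, it has
a left inverse. For an MPU tensor the physical index is the pair (output, input). -/
def TensorInjective {κ : Type*} [Fintype κ] {n : ℕ} (A : κ → Matrix (Fin n) (Fin n) ℂ) : Prop :=
  ∃ Ainv : κ → Matrix (Fin n) (Fin n) ℂ, ∀ a b a' b' : Fin n,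
    ∑ i, Ainv i a b * A i a' b' = if a = a' ∧ b = b' then 1 else 0

/-- The translation-invariant periodic MPS on `N` sites (as its coefficient vector). -/
noncomputable def mps {d n : ℕ} (A : Fin d → Matrix (Fin n) (Fin n) ℂ) (N : ℕ) :
    (Fin N → Fin d) → ℂ :=
  fun s => (word A (List.ofFn s)).trace

/-- The translation-invariant periodic matrix product operator on `N` sites. -/
noncomputable def mpo {d n : ℕ} (T : Fin d × Fin d → Matrix (Fin n) (Fin n) ℂ) (N : ℕ) :
    Matrix (Fin N → Fin d) (Fin N → Fin d) ℂ :=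
  Matrix.of fun s t => (word T (List.ofFn fun k => (s k, t k))).trace

/-- The tensor of the product of two matrix product operators (`T` on top of `S`). -/
noncomputable def compTensor {d : ℕ} {m n : Type*} (T : Fin d × Fin d → Matrix m m ℂ)
    (S : Fin d × Fin d → Matrix n n ℂ) : Fin d × Fin d → Matrix (m × n) (m × n) ℂ :=
  fun p => ∑ k, T (p.1, k) ⊗ₖ S (k, p.2)

/-- The tensor obtained by applying an operator tensor to the physical leg of `A`, where `A`
may have different left and right virtual spaces (as a domain wall tensor does). -/
noncomputable def actTensor {d : ℕ} {m n n' : Type*} (T : Fin d × Fin d → Matrix m m ℂ)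
    (A : Fin d → Matrix n n' ℂ) : Fin d → Matrix (m × n) (m × n') ℂ :=
  fun i => ∑ j, T (i, j) ⊗ₖ A j

/-- The overlap of two MPS on `N` sites. -/
noncomputable def overlap {d n m : ℕ} (A : Fin d → Matrix (Fin n) (Fin n) ℂ)
    (B : Fin d → Matrix (Fin m) (Fin m) ℂ) (N : ℕ) : ℂ :=
  ∑ s, star (mps A N s) * mps B N s

/-- The pair of left tensor `P` and right tensor `Q` locally reduces the tensor `B` to `A`:
`P B ⋯ B Q = A ⋯ A` for any number `≥ 0` of sites, and
`B Q A ⋯ A P B = B B ⋯ B B` for any number `≥ 1` of sites in the middle. -/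
def IsReduction {κ m : Type*} [Fintype m] [DecidableEq m] {n : ℕ}
    (B : κ → Matrix m m ℂ) (A : κ → Matrix (Fin n) (Fin n) ℂ)
    (P : Matrix (Fin n) m ℂ) (Q : Matrix m (Fin n) ℂ) : Prop :=
  (∀ l : List κ, P * word B l * Q = word A l) ∧
  (∀ (i k : κ) (l : List κ), l ≠ [] →
    B i * Q * word A l * P * B k = B i * word B l * B k)

/-- A spin chain with a matrix product unitary representation of `G`, together with a family of
injective MPS, indexed by `I`, which is permuted transitively by it: `U_g ψ_x = ψ_{gx}`. -/
structure System (G I : Type*) [Group G] [MulAction G I] where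
  /-- dimension of the local Hilbert space -/
  d : ℕ
  /-- bond dimensions of the MPUs -/
  χ : G → ℕ
  /-- MPU tensors -/
  T : ∀ g, Fin d × Fin d → Matrix (Fin (χ g)) (Fin (χ g)) ℂ
  T_injective : ∀ g, TensorInjective (T g)
  unitary : ∀ g N, 1 ≤ N → mpo (T g) N ∈ Matrix.unitaryGroup (Fin N → Fin d) ℂ
  mpo_one : ∀ N, 1 ≤ N → mpo (T 1) N = 1
  mpo_mul : ∀ g h N, 1 ≤ N → mpo (T g) N * mpo (T h) N = mpo (T (g * h)) N
  /-- bond dimensions of the MPS -/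
  D : I → ℕ
  /-- MPS tensors -/
  A : ∀ x, Fin d → Matrix (Fin (D x)) (Fin (D x)) ℂ
  D_pos : ∀ x, 0 < D x
  A_injective : ∀ x, TensorInjective (A x)
  /-- different ground states become orthogonal in the thermodynamic limit -/
  orthogonal : ∀ x y, x ≠ y → Tendsto (fun N => ‖overlap (A x) (A y) N‖ ^ 2 /
    (‖overlap (A x) (A x) N‖ * ‖overlap (A y) (A y) N‖)) atTop (𝓝 0)
  transitive : MulAction.IsPretransitive G I
  permutes : ∀ g x N, 1 ≤ N → (mpo (T g) N).mulVec (mps (A x) N) = mps (A (g • x)) N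

/-- The unbroken symmetry group: all `h` with `h x = x` for every ground state label `x`. -/
abbrev unbroken (G I : Type*) [Group G] [MulAction G I] : Subgroup G :=
  fixingSubgroup G (Set.univ : Set I)

section

variable {G I : Type*} [Group G] [MulAction G I] (S : System G I)

/-- Right tensors `V_{g,h}` of a family of fusion tensors. -/
abbrev FusionRight := ∀ g h : G, Matrix (Fin (S.χ g) × Fin (S.χ h)) (Fin (S.χ (g * h))) ℂ

/-- Left tensors `V̂_{g,h}` of a family of fusion tensors. -/
abbrev FusionLeft := ∀ g h : G, Matrix (Fin (S.χ (g * h))) (Fin (S.χ g) × Fin (S.χ h)) ℂ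

/-- Right tensors `W_{g,x}` of a family of action tensors. -/
abbrev ActionRight := ∀ (g : G) (x : I),
  Matrix (Fin (S.χ g) × Fin (S.D x)) (Fin (S.D (g • x))) ℂ

/-- Left tensors `Ŵ_{g,x}` of a family of action tensors. -/
abbrev ActionLeft := ∀ (g : G) (x : I),
  Matrix (Fin (S.D (g • x))) (Fin (S.χ g) × Fin (S.D x)) ℂ

/-- `(V, V̂)` are fusion tensors of the MPU representation. -/
def IsFusion (V : FusionRight S) (Vhat : FusionLeft S) : Prop :=
  ∀ g h, IsReduction (compTensor (S.T g) (S.T h)) (S.T (g * h)) (Vhat g h) (V g h)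

/-- `(W, Ŵ)` are action tensors of the MPU representation on the MPS. -/
def IsAction (W : ActionRight S) (What : ActionLeft S) : Prop :=
  ∀ g x, IsReduction (actTensor (S.T g) (S.A x)) (S.A (g • x)) (What g x) (W g x)

/-- First `V_{g,h}` fuses the two MPU tensors, then `W_{gh,x}` acts. -/
noncomputable def fuseThenAct (V : FusionRight S) (W : ActionRight S) (g h : G) (x : I) :
    Matrix (Fin (S.χ g) × Fin (S.χ h) × Fin (S.D x)) (Fin (S.D (g • h • x))) ℂ :=
  ((V g h ⊗ₖ (1 : Matrix (Fin (S.D x)) (Fin (S.D x)) ℂ)).submatrix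
      (Equiv.prodAssoc _ _ _).symm id) *
    (W (g * h) x).submatrix id (Fin.cast (congrArg S.D (mul_smul g h x)).symm)

/-- First `W_{h,x}` acts, then `W_{g,hx}`. -/
noncomputable def actTwice (W : ActionRight S) (g h : G) (x : I) :
    Matrix (Fin (S.χ g) × Fin (S.χ h) × Fin (S.D x)) (Fin (S.D (g • h • x))) ℂ :=
  ((1 : Matrix (Fin (S.χ g)) (Fin (S.χ g)) ℂ) ⊗ₖ W h x) * W g (h • x)

/-- `L g h x` is the L-symbol `L^x_{g,h}`: attached to (three sites of) the tensors of `U_g`, `U_h`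
and `ψ_x` on top of each other, the two ways of reducing differ by the factor `L^x_{g,h}`. -/
def IsLSymbol (V : FusionRight S) (W : ActionRight S) (L : G → G → I → ℂˣ) : Prop :=
  ∀ (g h : G) (x : I) (i j k : Fin S.d),
    let M := actTensor (S.T g) (actTensor (S.T h) (S.A x))
    M i * M j * M k * fuseThenAct S V W g h x =
      (L g h x : ℂ) • (M i * M j * M k * actTwice S W g h x)

/-- Tensors `e_{xy}` interfacing between the ground states `x` (left) and `y` (right). -/
abbrev WallTensors := ∀ x y : I, Fin S.d → Matrix (Fin (S.D x)) (Fin (S.D y)) ℂ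

/-- The state `ψ(x,y)` on a ring of `a + b + 2` sites:
`Tr[e_{xy} A_y ⋯ A_y e_{yx} A_x ⋯ A_x]` with `a` tensors `A_y` and `b` tensors `A_x`. -/
noncomputable def wallState (e : WallTensors S) (x y : I) (a b : ℕ) :
    (Fin (a + b + 2) → Fin S.d) → ℂ := fun s =>
  (e x y (s ⟨0, by omega⟩) *
    word (S.A y) (List.ofFn fun k : Fin a => s ⟨k.1 + 1, by omega⟩) *
    e y x (s ⟨a + 1, by omega⟩) *
    word (S.A x) (List.ofFn fun k : Fin b => s ⟨a + 2 + k.1, by omega⟩)).trace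

/-- Non-zero tensors `e_{xy}` such that the MPUs permute the domain wall states,
`U_g ψ(x,y) ∝ ψ(gx,gy)`, as soon as the two walls are far enough apart. -/
def ArePermutedWalls (e : WallTensors S) : Prop :=
  (∀ x y, e x y ≠ 0) ∧
  ∀ (g : G) (x y : I), ∃ R : ℕ, ∀ a b : ℕ, R ≤ a → R ≤ b → ∃ c : ℂ,
    (mpo (S.T g) (a + b + 2)).mulVec (wallState S e x y a b) =
      c • wallState S e (g • x) (g • y) a b

/-- `B g x y` is the factor `B^g_{x,y}`, which encodes the permutation of the walls locally:
`Ŵ_{g,x} (T A_x)(T e_{xy})(T A_y) W_{g,y} = B^g_{x,y} A_{gx} e_{gx,gy} A_{gy}`. -/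
def IsWallPhase (W : ActionRight S) (What : ActionLeft S) (e : WallTensors S)
    (B : G → I → I → ℂˣ) : Prop :=
  ∀ (g : G) (x y : I) (i j k : Fin S.d),
    What g x * actTensor (S.T g) (S.A x) i * actTensor (S.T g) (e x y) j *
        actTensor (S.T g) (S.A y) k * W g y =
      (B g x y : ℂ) • (S.A (g • x) i * e (g • x) (g • y) j * S.A (g • y) k)

/-- `R h` is the action of the unbroken symmetry `h` on the whole space of domain wall tensors
between `y` and `x`: `Ŵ_{h,y} (T A_y)(T e)(T A_x) W_{h,x} = A_{hy} (R h e) A_{hx}`, where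
`hy = y` and `hx = x`. -/
def IsWallAction (W : ActionRight S) (What : ActionLeft S) (y x : I)
    (R : unbroken G I → Module.End ℂ (Fin S.d → Matrix (Fin (S.D y)) (Fin (S.D x)) ℂ)) : Prop :=
  ∀ (h : unbroken G I) (e : Fin S.d → Matrix (Fin (S.D y)) (Fin (S.D x)) ℂ) (i j k : Fin S.d),
    What h y * actTensor (S.T h) (S.A y) i * actTensor (S.T h) e j *
        actTensor (S.T h) (S.A x) k * W h x =
      S.A ((h : G) • y) i *
        (R h e j).submatrix (Fin.cast (congrArg S.D (h.2 ⟨y, Set.mem_univ y⟩)))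
          (Fin.cast (congrArg S.D (h.2 ⟨x, Set.mem_univ x⟩))) *
        S.A ((h : G) • x) k

end

/-- The factor `L^y_{h₁,h₂} / L^x_{h₁,h₂}` on the unbroken subgroup. -/
def wallFactor {G I : Type*} [Group G] [MulAction G I] (L : G → G → I → ℂˣ) (y x : I) :
    unbroken G I → unbroken G I → ℂˣ :=
  fun h₁ h₂ => L h₁ h₂ y / L h₁ h₂ x

/-- Two-cocycles with values in the trivial module `ℂˣ`. -/
def IsTwoCocycle {H : Type*} [Group H] (f : H → H → ℂˣ) : Prop :=
  ∀ h₁ h₂ h₃, f h₁ h₂ * f (h₁ * h₂) h₃ = f h₁ (h₂ * h₃) * f h₂ h₃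

/-- Two-coboundaries with values in the trivial module `ℂˣ`. -/
def IsTwoCoboundary {H : Type*} [Group H] (f : H → H → ℂˣ) : Prop :=
  ∃ c : H → ℂˣ, ∀ h₁ h₂, f h₁ h₂ = c h₁ * c h₂ / c (h₁ * h₂)

end DomainWall

namespace DomainWall

/-! Everything rests on one rigidity statement, `ReducesAt.exists_proportional`. Let `(P, Q)` and
`(P', Q')` reduce `B` to the same injective tensor `A`. Because words in `A` span the full matrix
algebra, the insertion property gives `B⋯B Q X P B⋯B = B⋯B Q' X P' B⋯B` for every matrix `X`. Taking
matrix units for `X` turns this into an equality of two non-zero product tensors, so the dressed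
right tensors differ by a number and the dressed left tensors by its inverse. Reductions compose
(`ReducesAt.trans`), at the price of more sites on either side.

Applied to the two ways of reducing `T_g T_h A_x`, this yields the L-symbols; applied to three
stacked MPU tensors, it yields a number `F` that knows nothing of the ground state. Rebracketing
`T_a T_b T_c A_x` along two paths gives the coupled pentagon equation `IsLSymbol.pentagon`. On the
unbroken subgroup the label `x` is fixed, so dividing the equation at `y` by the one at `x` cancels
`F` and leaves the cocycle condition.

For the B-phases, the permutation of wall states is an equality of traces on a ring. Injectivity of
the tensors between the walls opens the ring: products of an entry of the reduced wall `xy` with one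
of the reduced wall `yx` agree up to one constant, which makes each wall reproduce itself up to a
number (`ArePermutedWalls.exists_phase`). The composition law `IsWallPhase.mul` comes from
evaluating one doubly acted wall, with mismatched reductions on its two sides, in two ways: either
the left or the right tensors are exchanged, which costs `L^y` or `L^x`.

Moduli are handled by averaging. The numbers `log |L|` solve the additive pentagon equation over the
reals; an average over ground states removes `log |F|`, and an average over the group then
trivializes the solution. Once the L-symbols are phases, `|B|` is a homomorphism from a finite group
to the reals, hence trivial.

The projective example uses on-site unitaries. A site carries a ground state label and two virtual
indices, the ground states consist of maximally entangled pairs, and any unitary projective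
representation of the action groupoid (`ProjRep`) gives such a system, with the inverse multiplier
as L-symbol. In the wreath product of the Klein four-group with `ZMod 2`, each Klein factor acts by
Pauli matrices at one of two ground states; the factor is then not symmetric on a commuting pair,
which excludes a coboundary. -/

theorem mul_single_mul_apply {l m n o : Type*} [Fintype m] [Fintype n] [DecidableEq m]
    [DecidableEq n] (M : Matrix l m ℂ) (N : Matrix n o ℂ) (a : l) (b : m) (c : n) (d : o) :
    (M * Matrix.single b c (1 : ℂ) * N : Matrix l o ℂ) a d = M a b * N c d := by
  simp [Matrix.mul_apply, Matrix.single_apply, ite_and, Finset.sum_ite_eq]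

/-! ### Words in a tensor and the spanning property of injective tensors -/

section Words

variable {κ m : Type*} [Fintype m] [DecidableEq m]

@[simp] theorem word_nil (A : κ → Matrix m m ℂ) : word A [] = 1 := rfl

@[simp] theorem word_cons (A : κ → Matrix m m ℂ) (i : κ) (l : List κ) :
    word A (i :: l) = A i * word A l := by
  simp [word]

@[simp] theorem word_append (A : κ → Matrix m m ℂ) (l l' : List κ) :
    word A (l ++ l') = word A l * word A l' := by
  simp [word]

theorem word_submatrix {m' : Type*} [Fintype m'] [DecidableEq m'] (A : κ → Matrix m m ℂ)
    (e : m' ≃ m) (l : List κ) :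
    word (fun i => (A i).submatrix e e) l = (word A l).submatrix e e := by
  induction l with
  | nil => simp
  | cons i l ih => simp [ih, Matrix.submatrix_mul_equiv]

/-- The matrices of an injective tensor span the whole matrix algebra. -/
theorem TensorInjective.span_eq_top [Fintype κ] {n : ℕ} {A : κ → Matrix (Fin n) (Fin n) ℂ}
    (hA : TensorInjective A) : Submodule.span ℂ (Set.range A) = ⊤ := by
  obtain ⟨C, hC⟩ := hA
  refine eq_top_iff.2 fun X _ => ?_
  have : X = ∑ i, (∑ a, ∑ b, X a b * C i a b) • A i := by
    ext a' b'
    simp only [Matrix.sum_apply, Matrix.smul_apply, smul_eq_mul, Finset.sum_mul]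
    rw [Finset.sum_comm]
    simp_rw [Finset.sum_comm (s := Finset.univ (α := κ)), mul_assoc, ← Finset.mul_sum, hC]
    simp [ite_and]
  rw [this]
  exact Submodule.sum_mem _ fun i _ =>
    Submodule.smul_mem _ _ (Submodule.subset_span ⟨i, rfl⟩)

/-- So do the products of any fixed non-zero number of them. -/
theorem TensorInjective.span_word [Fintype κ] {n : ℕ} {A : κ → Matrix (Fin n) (Fin n) ℂ}
    (hA : TensorInjective A) (k : ℕ) :
    Submodule.span ℂ (word A '' {l | l.length = k + 1}) = ⊤ := by
  induction k with
  | zero =>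
    refine eq_top_iff.2 (hA.span_eq_top.ge.trans (Submodule.span_mono ?_))
    rintro _ ⟨i, rfl⟩
    exact ⟨[i], rfl, by simp⟩
  | succ k ih =>
    have h : (⊤ : Submodule ℂ (Matrix (Fin n) (Fin n) ℂ)) ≤ ⊤ * ⊤ := fun X _ => by
      simpa using Submodule.mul_mem_mul (Submodule.mem_top (x := X))
        (Submodule.mem_top (x := (1 : Matrix (Fin n) (Fin n) ℂ)))
    refine eq_top_iff.2 (h.trans ?_)
    nth_rewrite 1 [← hA.span_eq_top]
    rw [← ih, Submodule.span_mul_span]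
    refine Submodule.span_mono ?_
    rintro _ ⟨_, ⟨i, rfl⟩, _, ⟨l, hl, rfl⟩, rfl⟩
    exact ⟨i :: l, by simpa using hl, by simp⟩

/-- Words of one fixed length already span, so identities known on physical configurations extend to
arbitrary virtual matrices. -/
theorem TensorInjective.linearMap_ext [Fintype κ] {n : ℕ}
    {A : κ → Matrix (Fin n) (Fin n) ℂ} (hA : TensorInjective A) (k : ℕ) {E : Type*}
    [AddCommMonoid E] [Module ℂ E] {f f' : Matrix (Fin n) (Fin n) ℂ →ₗ[ℂ] E}
    (h : ∀ l : List κ, l.length = k + 1 → f (word A l) = f' (word A l)) : f = f' := by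
  refine LinearMap.ext_on (hA.span_word k) ?_
  rintro _ ⟨l, hl, rfl⟩
  exact h l hl

theorem TensorInjective.exists_word_ne_zero [Fintype κ] {n : ℕ} (hn : 0 < n)
    {A : κ → Matrix (Fin n) (Fin n) ℂ} (hA : TensorInjective A) (k : ℕ) :
    ∃ l : List κ, l.length = k + 1 ∧ word A l ≠ 0 := by
  by_contra! h
  have : (LinearMap.id : Matrix (Fin n) (Fin n) ℂ →ₗ[ℂ] _) = 0 :=
    hA.linearMap_ext k fun l hl => by simpa using h l hl
  have h1 := congrFun (congrFun (LinearMap.congr_fun this 1) ⟨0, hn⟩) ⟨0, hn⟩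
  simp at h1

end Words

/-! ### Composition and rigidity of reductions -/

section Reductions

variable {κ m n : Type*} [Fintype m] [DecidableEq m] [Fintype n] [DecidableEq n]

/-- `P` and `Q` reduce `B` to `A`, once there are at least `r` tensors `B` on either side. -/
structure ReducesAt (r : ℕ) (B : κ → Matrix m m ℂ) (A : κ → Matrix n n ℂ)
    (P : Matrix n m ℂ) (Q : Matrix m n ℂ) : Prop where
  word_eq : ∀ l, P * word B l * Q = word A l
  insert_eq : ∀ u v l, r ≤ u.length → r ≤ v.length → l ≠ [] →
    word B u * Q * word A l * P * word B v = word B u * word B l * word B v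

theorem IsReduction.reducesAt {n : ℕ} {B : κ → Matrix m m ℂ}
    {A : κ → Matrix (Fin n) (Fin n) ℂ} {P : Matrix (Fin n) m ℂ} {Q : Matrix m (Fin n) ℂ}
    (h : IsReduction B A P Q) : ReducesAt 1 B A P Q := by
  refine ⟨h.1, fun u v l hu hv hl => ?_⟩
  obtain ⟨u, i, rfl⟩ : ∃ u' i, u = u' ++ [i] :=
    ⟨_, _, (List.dropLast_append_getLast (List.ne_nil_of_length_pos hu)).symm⟩
  obtain ⟨k, v, rfl⟩ := List.exists_cons_of_length_pos hv
  have := congrArg (fun X => word B u * X * word B v) (h.2 i k l hl)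
  simpa [mul_assoc, Matrix.mul_assoc] using this

namespace ReducesAt

variable {r : ℕ} {B : κ → Matrix m m ℂ} {A : κ → Matrix n n ℂ} {P : Matrix n m ℂ}
  {Q : Matrix m n ℂ}

/-- Insert `Q A P` at the first letter of `w`; the remaining letters then stand between `P` and `Q`,
where they become letters of `A`. One letter is needed for the middle and `r` for the outer block,
hence `r + 1`. -/
theorem absorb_right (h : ReducesAt r B A P Q) {u w : List κ} (hu : r ≤ u.length)
    (hw : r + 1 ≤ w.length) : word B u * word B w * Q = word B u * Q * word A w := by
  have h1 := h.insert_eq u (w.drop 1) (w.take 1) hu (by simp; omega)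
    (List.ne_nil_of_length_pos (by simp; omega))
  have h2 := congrArg (· * Q) h1
  have h3 := h.word_eq (w.drop 1)
  have e : ∀ C : κ → Matrix m m ℂ, word C w = word C (w.take 1) * word C (w.drop 1) := fun C => by
    rw [← word_append, List.take_append_drop]
  have e' : ∀ C : κ → Matrix n n ℂ, word C w = word C (w.take 1) * word C (w.drop 1) :=
    fun C => by rw [← word_append, List.take_append_drop]
  rw [e, e', ← h3]
  simpa only [Matrix.mul_assoc] using h2.symm

theorem absorb_left (h : ReducesAt r B A P Q) {w v : List κ} (hv : r ≤ v.length)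
    (hw : r + 1 ≤ w.length) : P * (word B w * word B v) = word A w * (P * word B v) := by
  have h1 := h.insert_eq (w.take r) v (w.drop r) (by simp; omega) hv
    (List.ne_nil_of_length_pos (by simp; omega))
  have h2 := congrArg (P * ·) h1
  have h3 := h.word_eq (w.take r)
  have e : ∀ C : κ → Matrix m m ℂ, word C w = word C (w.take r) * word C (w.drop r) := fun C => by
    rw [← word_append, List.take_append_drop]
  have e' : ∀ C : κ → Matrix n n ℂ, word C w = word C (w.take r) * word C (w.drop r) :=
    fun C => by rw [← word_append, List.take_append_drop]
  rw [e, e', ← h3]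
  simpa only [Matrix.mul_assoc] using h2.symm

theorem submatrix {m' : Type*} [Fintype m'] [DecidableEq m'] (h : ReducesAt r B A P Q)
    (e : m' ≃ m) :
    ReducesAt r (fun i => (B i).submatrix e e) A (P.submatrix id e) (Q.submatrix e id) := by
  constructor
  · intro l
    rw [word_submatrix, Matrix.submatrix_mul_equiv, Matrix.submatrix_mul_equiv, h.word_eq]
    rfl
  · intro u v l hu hv hl
    have e1 := congrArg (fun X => X.submatrix e e) (h.insert_eq u v l hu hv hl)
    have e2 : ∀ (X : Matrix m m ℂ) (W : Matrix n n ℂ) (Y : Matrix m m ℂ),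
        (X * Q * W * P * Y).submatrix e e = X.submatrix e e * Q.submatrix e id * W *
          P.submatrix id e * Y.submatrix e e := fun X W Y => by
      rw [← Matrix.submatrix_mul_equiv _ _ _ e, Matrix.submatrix_mul _ P e id e
        Function.bijective_id, Matrix.submatrix_mul _ W e id id Function.bijective_id,
        ← Matrix.submatrix_mul_equiv _ _ _ e, Matrix.submatrix_id_id]
    simp only [word_submatrix, Matrix.submatrix_mul_equiv]
    rw [← e1, e2]
    simp only [Matrix.submatrix_mul_equiv]

/-- On each side `r` outer tensors stay as they are and the rest are converted to `A`. The
conversion needs `r + 1` further ones, hence `2 * r + 1`; the second reduction needs `s` converted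
ones, hence `r + s`. -/
theorem trans {s t : ℕ} {p : Type*} [Fintype p] [DecidableEq p] {A' : κ → Matrix p p ℂ}
    {P' : Matrix p n ℂ} {Q' : Matrix n p ℂ} (h : ReducesAt r B A P Q)
    (h' : ReducesAt s A A' P' Q') (h1 : 2 * r + 1 ≤ t) (h2 : r + s ≤ t) :
    ReducesAt t B A' (P' * P) (Q * Q') := by
  constructor
  · intro l
    rw [← h'.word_eq, ← h.word_eq]
    simp only [Matrix.mul_assoc]
  · intro u v l hu hv hl
    have hu' : word B u = word B (u.take r) * word B (u.drop r) := by
      rw [← word_append, List.take_append_drop]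
    have hv' : word B v = word B (v.take (v.length - r)) * word B (v.drop (v.length - r)) := by
      rw [← word_append, List.take_append_drop]
    have e1 : word B u * Q = word B (u.take r) * Q * word A (u.drop r) := by
      rw [hu', h.absorb_right (by simp; omega) (by simp; omega)]
    have e2 : P * word B v =
        word A (v.take (v.length - r)) * (P * word B (v.drop (v.length - r))) := by
      rw [hv', h.absorb_left (by simp; omega) (by simp; omega)]
    have e3 := h'.insert_eq (u.drop r) (v.take (v.length - r)) l (by simp; omega)
      (by simp; omega) hl
    have e4 := h.insert_eq (u.take r) (v.drop (v.length - r))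
      (u.drop r ++ l ++ v.take (v.length - r)) (by simp; omega) (by simp; omega)
      (by simp [hl])
    calc word B u * (Q * Q') * word A' l * (P' * P) * word B v
        = (word B u * Q) * (Q' * word A' l * P') * (P * word B v) := by
          simp only [Matrix.mul_assoc]
      _ = word B (u.take r) * Q * (word A (u.drop r) * Q' * word A' l * P' *
            word A (v.take (v.length - r))) * P * word B (v.drop (v.length - r)) := by
          rw [e1, e2]; simp only [Matrix.mul_assoc]
      _ = _ := by
          rw [e3, hu', hv']
          simpa only [Matrix.mul_assoc, word_append] using e4

end ReducesAt

/-- `Q` and `Q'` agree up to the factor `c` once `r` tensors `B` are attached to them. -/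
def Proportional {p : Type*} (r : ℕ) (B : κ → Matrix m m ℂ) (c : ℂ) (Q Q' : Matrix m p ℂ) :
    Prop :=
  ∀ u : List κ, r ≤ u.length → word B u * Q = c • (word B u * Q')

namespace Proportional

variable {p : Type*} {r : ℕ} {B : κ → Matrix m m ℂ} {c c' : ℂ} {Q Q' Q'' : Matrix m p ℂ}

theorem of_length_eq (h : ∀ u : List κ, u.length = r → word B u * Q = c • (word B u * Q')) :
    Proportional r B c Q Q' := by
  intro u hu
  have hu' : word B u = word B (u.take (u.length - r)) * word B (u.drop (u.length - r)) := by
    rw [← word_append, List.take_append_drop]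
  rw [hu', Matrix.mul_assoc, h _ (by simp; omega), Matrix.mul_assoc, Matrix.mul_smul]

theorem mono {s : ℕ} (h : Proportional r B c Q Q') (hrs : r ≤ s) : Proportional s B c Q Q' :=
  fun u hu => h u (hrs.trans hu)

theorem trans (h : Proportional r B c Q Q') (h' : Proportional r B c' Q' Q'') :
    Proportional r B (c * c') Q Q'' := fun u hu => by
  rw [h u hu, h' u hu, smul_smul]

theorem mul_right {q : Type*} [Fintype p] (h : Proportional r B c Q Q') (Y : Matrix p q ℂ) :
    Proportional r B c (Q * Y) (Q' * Y) := fun u hu => by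
  rw [← Matrix.mul_assoc, h u hu, Matrix.smul_mul, Matrix.mul_assoc]

/-- The tensors `B` can be moved through `X`, where they become the tensors `A` that the given
proportionality requires. -/
theorem mul_left {s t : ℕ} {A : κ → Matrix n n ℂ} {P : Matrix n m ℂ} {X : Matrix m n ℂ}
    {Y Y' : Matrix n p ℂ} (hX : ReducesAt s B A P X) (h : Proportional r A c Y Y')
    (h1 : 2 * s + 1 ≤ t) (h2 : s + r ≤ t) : Proportional t B c (X * Y) (X * Y') := fun u hu => by
  have e1 : word B u * X = word B (u.take s) * X * word A (u.drop s) := by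
    rw [← hX.absorb_right (by simp; omega) (by simp; omega), ← word_append,
      List.take_append_drop]
  rw [← Matrix.mul_assoc, ← Matrix.mul_assoc, e1, Matrix.mul_assoc, Matrix.mul_assoc _ _ Y',
    h _ (by simp; omega), Matrix.mul_smul]

theorem submatrix {m' : Type*} [Fintype m'] [DecidableEq m'] (h : Proportional r B c Q Q')
    (e : m' ≃ m) :
    Proportional r (fun i => (B i).submatrix e e) c (Q.submatrix e id) (Q'.submatrix e id) :=
  fun u hu => by
  rw [word_submatrix, Matrix.submatrix_mul_equiv, h u hu, Matrix.submatrix_mul_equiv]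
  rfl

/-- The factor is determined if `Q'` belongs to a reduction to an injective tensor. -/
theorem unique [Fintype κ] {k : ℕ} {B : κ → Matrix m m ℂ} {A : κ → Matrix (Fin k) (Fin k) ℂ}
    {Q Q' : Matrix m (Fin k) ℂ} {P' : Matrix (Fin k) m ℂ} (hk : 0 < k) (hA : TensorInjective A)
    (hQ' : ∀ l, P' * word B l * Q' = word A l)
    (h : Proportional r B c Q Q') (h' : Proportional r B c' Q Q') : c = c' := by
  obtain ⟨l, hl, h0⟩ := hA.exists_word_ne_zero hk r
  have h1 : c • word A l = c' • word A l := by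
    rw [← hQ', Matrix.mul_assoc, ← Matrix.mul_smul, ← h l (by omega), h' l (by omega),
      Matrix.mul_smul]
  exact smul_left_injective ℂ h0 h1

end Proportional

/-- Two reductions to the same injective tensor agree up to a number. -/
theorem ReducesAt.exists_proportional [Fintype κ] {k r : ℕ} {B : κ → Matrix m m ℂ}
    {A : κ → Matrix (Fin k) (Fin k) ℂ} {P P' : Matrix (Fin k) m ℂ} {Q Q' : Matrix m (Fin k) ℂ}
    (hk : 0 < k) (hA : TensorInjective A) (h : ReducesAt r B A P Q)
    (h' : ReducesAt r B A P' Q') :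
    ∃ c : ℂˣ, Proportional r B c Q Q' ∧
      ∀ v : List κ, r ≤ v.length → P' * word B v = (c : ℂ) • (P * word B v) := by
  -- Both reductions have the same right-hand side in `insert_eq`, and the words in between can be
  -- replaced by any `X`.
  have key : ∀ u v : List κ, r ≤ u.length → r ≤ v.length → ∀ X : Matrix (Fin k) (Fin k) ℂ,
      word B u * Q * X * (P * word B v) = word B u * Q' * X * (P' * word B v) := by
    intro u v hu hv X
    let f (P : Matrix (Fin k) m ℂ) (Q : Matrix m (Fin k) ℂ) :
        Matrix (Fin k) (Fin k) ℂ →ₗ[ℂ] Matrix m m ℂ :=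
      { toFun := fun X => word B u * Q * X * (P * word B v)
        map_add' := fun X Y => by simp [Matrix.mul_add, Matrix.add_mul]
        map_smul' := fun c X => by simp }
    refine LinearMap.congr_fun (f := f P Q) (g := f P' Q') (hA.linearMap_ext 0 fun l hl => ?_) X
    have hl' : l ≠ [] := List.ne_nil_of_length_pos (by omega)
    have := (h.insert_eq u v l hu hv hl').trans (h'.insert_eq u v l hu hv hl').symm
    simpa only [f, LinearMap.coe_mk, AddHom.coe_mk, Matrix.mul_assoc] using this
  -- A matrix unit as `X` separates the two outer factors.
  have key' : ∀ u v : List κ, r ≤ u.length → r ≤ v.length → ∀ a b c d,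
      (word B u * Q) a b * (P * word B v) c d = (word B u * Q') a b * (P' * word B v) c d := by
    intro u v hu hv a b c d
    have := congrFun (congrFun (key u v hu hv (Matrix.single b c 1)) a) d
    simpa only [mul_single_mul_apply] using this
  obtain ⟨w, hw, hw0⟩ := hA.exists_word_ne_zero hk r
  have ne1 : P * word B w ≠ 0 := fun h0 => hw0 (by rw [← h.word_eq, h0, Matrix.zero_mul])
  have ne2 : word B w * Q' ≠ 0 := fun h0 => hw0 (by
    rw [← h'.word_eq, Matrix.mul_assoc, h0, Matrix.mul_zero])
  have ne3 : word B w * Q ≠ 0 := fun h0 => hw0 (by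
    rw [← h.word_eq, Matrix.mul_assoc, h0, Matrix.mul_zero])
  obtain ⟨c, d, hcd⟩ : ∃ c d, (P * word B w) c d ≠ 0 := by
    by_contra! h0; exact ne1 (Matrix.ext h0)
  obtain ⟨a, b, hab⟩ : ∃ a b, (word B w * Q') a b ≠ 0 := by
    by_contra! h0; exact ne2 (Matrix.ext h0)
  obtain ⟨a', b', hab'⟩ : ∃ a b, (word B w * Q) a b ≠ 0 := by
    by_contra! h0; exact ne3 (Matrix.ext h0)
  have hw' : r ≤ w.length := by omega
  have hz : (P' * word B w) c d ≠ 0 := fun h0 => by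
    have := key' w w hw' hw' a' b' c d
    rw [h0, mul_zero] at this
    exact mul_ne_zero hab' hcd this
  -- A ratio at one non-zero entry of the left tensors fixes the factor for all right tensors; the
  -- reverse comparison then recovers the relation of all left tensors.
  set z := (P' * word B w) c d / (P * word B w) c d with hzdef
  have hz0 : z ≠ 0 := div_ne_zero hz hcd
  have hQ : ∀ u : List κ, r ≤ u.length → word B u * Q = z • (word B u * Q') := by
    intro u hu
    ext a b
    have := key' u w hu hw' a b c d
    rw [Matrix.smul_apply, smul_eq_mul, hzdef]
    field_simp
    rw [this, mul_comm]
  refine ⟨Units.mk0 z hz0, hQ, fun v hv => ?_⟩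
  ext c' d'
  have := key' w v hw' hv a b c' d'
  rw [hQ w hw', Matrix.smul_apply, smul_eq_mul] at this
  have h2 : (word B w * Q') a b * (P' * word B v) c' d' =
      (word B w * Q') a b * (z * (P * word B v) c' d') := by rw [← this]; ring
  simpa using mul_left_cancel₀ hab h2

end Reductions

/-! ### Reductions inside one layer of a stack -/

section Layers

variable {α ι κ₁ κ₂ m n : Type*}

/-- A tensor `T` on top of a tensor `B`, contracted along an index `j : ι`. -/
noncomputable def layer [Fintype ι] (f : α → ι → κ₁) (h : α → ι → κ₂) (T : κ₁ → Matrix m m ℂ)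
    (B : κ₂ → Matrix n n ℂ) : α → Matrix (m × n) (m × n) ℂ :=
  fun p => ∑ j, T (f p j) ⊗ₖ B (h p j)

/-- The list of indices of one of the layers, given those of the contracted legs. -/
def legs {κ : Type*} (f : α → ι → κ) (u : List α) (t : Fin u.length → ι) : List κ :=
  List.ofFn fun k => f (u.get k) (t k)

@[simp] theorem length_legs {κ : Type*} (f : α → ι → κ) (u : List α) (t : Fin u.length → ι) :
    (legs f u t).length = u.length := by
  simp [legs]

variable [Fintype ι] [Fintype m] [DecidableEq m] [Fintype n] [DecidableEq n]

/-- After expansion over the contracted legs each term is a Kronecker product of words, so a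
reduction of one layer can be applied term by term. -/
theorem word_layer (f : α → ι → κ₁) (h : α → ι → κ₂) (T : κ₁ → Matrix m m ℂ)
    (B : κ₂ → Matrix n n ℂ) (u : List α) :
    word (layer f h T B) u =
      ∑ t : Fin u.length → ι, word T (legs f u t) ⊗ₖ word B (legs h u t) := by
  induction u with
  | nil => simp [legs]
  | cons i u ih =>
    refine Eq.trans ?_ (Equiv.sum_comp (Fin.consEquiv fun _ : Fin (u.length + 1) => ι)
      fun t => word T (legs f (i :: u) t) ⊗ₖ word B (legs h (i :: u) t))
    simp only [word_cons, ih, layer, Fintype.sum_prod_type, Finset.sum_mul, Finset.mul_sum,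
      ← Matrix.mul_kronecker_mul]
    rw [Finset.sum_comm]
    simp [legs, List.ofFn_succ, Fin.consEquiv]

variable {f : α → ι → κ₁} {h : α → ι → κ₂}

theorem ReducesAt.layer_bot {n' : Type*} [Fintype n'] [DecidableEq n'] {r : ℕ}
    {B : κ₂ → Matrix n n ℂ} {A : κ₂ → Matrix n' n' ℂ} {P : Matrix n' n ℂ} {Q : Matrix n n' ℂ}
    (hB : ReducesAt r B A P Q) (f : α → ι → κ₁) (h : α → ι → κ₂) (T : κ₁ → Matrix m m ℂ) :
    ReducesAt r (layer f h T B) (layer f h T A) ((1 : Matrix m m ℂ) ⊗ₖ P)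
      ((1 : Matrix m m ℂ) ⊗ₖ Q) := by
  constructor
  · intro l
    simp only [word_layer, Matrix.sum_mul, Matrix.mul_sum,
      ← Matrix.mul_kronecker_mul, Matrix.one_mul, Matrix.mul_one, hB.word_eq]
  · intro u v l hu hv hl
    simp only [word_layer, Finset.sum_mul, Finset.mul_sum, Matrix.sum_mul, Matrix.mul_sum,
      ← Matrix.mul_kronecker_mul, Matrix.mul_one]
    refine Finset.sum_congr rfl fun t₁ _ => Finset.sum_congr rfl fun t₂ _ =>
      Finset.sum_congr rfl fun t₃ _ => ?_
    rw [hB.insert_eq _ _ _ (by simpa) (by simpa)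
      (List.ne_nil_of_length_pos (by simpa using List.length_pos_iff.2 hl))]

theorem ReducesAt.layer_top {m' : Type*} [Fintype m'] [DecidableEq m'] {r : ℕ}
    {T : κ₁ → Matrix m m ℂ} {U : κ₁ → Matrix m' m' ℂ} {P : Matrix m' m ℂ} {Q : Matrix m m' ℂ}
    (hT : ReducesAt r T U P Q) (f : α → ι → κ₁) (h : α → ι → κ₂) (A : κ₂ → Matrix n n ℂ) :
    ReducesAt r (layer f h T A) (layer f h U A) (P ⊗ₖ (1 : Matrix n n ℂ))
      (Q ⊗ₖ (1 : Matrix n n ℂ)) := by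
  constructor
  · intro l
    simp only [word_layer, Matrix.sum_mul, Matrix.mul_sum,
      ← Matrix.mul_kronecker_mul, Matrix.one_mul, Matrix.mul_one, hT.word_eq]
  · intro u v l hu hv hl
    simp only [word_layer, Finset.sum_mul, Finset.mul_sum, Matrix.sum_mul, Matrix.mul_sum,
      ← Matrix.mul_kronecker_mul, Matrix.mul_one]
    refine Finset.sum_congr rfl fun t₁ _ => Finset.sum_congr rfl fun t₂ _ =>
      Finset.sum_congr rfl fun t₃ _ => ?_
    rw [hT.insert_eq _ _ _ (by simpa) (by simpa)
      (List.ne_nil_of_length_pos (by simpa using List.length_pos_iff.2 hl))]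

theorem Proportional.layer_bot {p : Type*} {r : ℕ} {B : κ₂ → Matrix n n ℂ} {c : ℂ}
    {Q Q' : Matrix n p ℂ} (hB : Proportional r B c Q Q') (f : α → ι → κ₁) (h : α → ι → κ₂)
    (T : κ₁ → Matrix m m ℂ) :
    Proportional r (layer f h T B) c ((1 : Matrix m m ℂ) ⊗ₖ Q) ((1 : Matrix m m ℂ) ⊗ₖ Q') := by
  intro u hu
  simp only [word_layer, Matrix.sum_mul, Finset.smul_sum, ← Matrix.mul_kronecker_mul]
  refine Finset.sum_congr rfl fun t _ => ?_
  rw [hB _ (by simpa), Matrix.kronecker_smul]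

theorem Proportional.layer_top {p : Type*} {r : ℕ} {T : κ₁ → Matrix m m ℂ} {c : ℂ}
    {Q Q' : Matrix m p ℂ} (hT : Proportional r T c Q Q') (f : α → ι → κ₁) (h : α → ι → κ₂)
    (B : κ₂ → Matrix n n ℂ) :
    Proportional r (layer f h T B) c (Q ⊗ₖ (1 : Matrix n n ℂ)) (Q' ⊗ₖ (1 : Matrix n n ℂ)) := by
  intro u hu
  simp only [word_layer, Matrix.sum_mul, Finset.smul_sum, ← Matrix.mul_kronecker_mul]
  refine Finset.sum_congr rfl fun t _ => ?_
  rw [hT _ (by simpa), Matrix.smul_kronecker]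

end Layers

/-! ### Stacks of operator tensors and their reassociation -/

section Acting

variable {d : ℕ} {l m n n' p : Type*}

theorem actTensor_eq_layer (T : Fin d × Fin d → Matrix m m ℂ) (A : Fin d → Matrix n n ℂ) :
    actTensor T A = layer (fun i j => (i, j)) (fun _ j => j) T A := rfl

/-- Acting with two operator tensors is the same as acting with their product. -/
theorem actTensor_actTensor (T : Fin d × Fin d → Matrix l l ℂ)
    (S : Fin d × Fin d → Matrix m m ℂ) (A : Fin d → Matrix n n' ℂ) (i : Fin d) :
    actTensor T (actTensor S A) i = (actTensor (compTensor T S) A i).submatrix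
      (Equiv.prodAssoc l m n).symm (Equiv.prodAssoc l m n').symm := by
  ext ⟨a, b, c⟩ ⟨a', b', c'⟩
  simp only [actTensor, compTensor, Matrix.sum_apply, Matrix.kronecker_apply,
    Matrix.submatrix_apply, Equiv.prodAssoc_symm_apply, Finset.mul_sum, Finset.sum_mul]
  rw [Finset.sum_comm]
  simp only [mul_assoc]

theorem compTensor_compTensor (T : Fin d × Fin d → Matrix l l ℂ)
    (S : Fin d × Fin d → Matrix m m ℂ) (U : Fin d × Fin d → Matrix n n ℂ)
    (i : Fin d × Fin d) :
    compTensor T (compTensor S U) i = (compTensor (compTensor T S) U i).submatrix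
      (Equiv.prodAssoc l m n).symm (Equiv.prodAssoc l m n).symm := by
  ext ⟨a, b, c⟩ ⟨a', b', c'⟩
  simp only [compTensor, Matrix.sum_apply, Matrix.kronecker_apply,
    Matrix.submatrix_apply, Equiv.prodAssoc_symm_apply, Finset.mul_sum, Finset.sum_mul]
  rw [Finset.sum_comm]
  simp only [mul_assoc]

variable [Fintype l] [DecidableEq l] [Fintype m] [DecidableEq m] [Fintype n] [DecidableEq n]
  [Fintype p] [DecidableEq p]

/-- A right tensor fusing the two upper ones of three layers. -/
noncomputable def fuseRight (n : Type*) [DecidableEq n] (V : Matrix (l × m) p ℂ) :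
    Matrix (l × m × n) (p × n) ℂ :=
  (V ⊗ₖ (1 : Matrix n n ℂ)).submatrix (Equiv.prodAssoc l m n).symm id

/-- A left tensor fusing the two upper ones of three layers. -/
noncomputable def fuseLeft (n : Type*) [DecidableEq n] (V : Matrix p (l × m) ℂ) :
    Matrix (p × n) (l × m × n) ℂ :=
  (V ⊗ₖ (1 : Matrix n n ℂ)).submatrix id (Equiv.prodAssoc l m n).symm

theorem ReducesAt.fuse_act {r : ℕ} {T : Fin d × Fin d → Matrix l l ℂ}
    {S : Fin d × Fin d → Matrix m m ℂ} {U : Fin d × Fin d → Matrix p p ℂ}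
    {P : Matrix p (l × m) ℂ} {Q : Matrix (l × m) p ℂ}
    (h : ReducesAt r (compTensor T S) U P Q) (A : Fin d → Matrix n n ℂ) :
    ReducesAt r (actTensor T (actTensor S A)) (actTensor U A) (fuseLeft n P)
      (fuseRight n Q) := by
  rw [funext (actTensor_actTensor T S A)]
  exact (h.layer_top _ _ A).submatrix _

theorem ReducesAt.fuse_comp {r : ℕ} {T : Fin d × Fin d → Matrix l l ℂ}
    {S : Fin d × Fin d → Matrix m m ℂ} {U : Fin d × Fin d → Matrix p p ℂ}
    {P : Matrix p (l × m) ℂ} {Q : Matrix (l × m) p ℂ}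
    (h : ReducesAt r (compTensor T S) U P Q) (A : Fin d × Fin d → Matrix n n ℂ) :
    ReducesAt r (compTensor T (compTensor S A)) (compTensor U A) (fuseLeft n P)
      (fuseRight n Q) := by
  rw [funext (compTensor_compTensor T S A)]
  exact (h.layer_top _ _ A).submatrix _

/-- Reductions of the product of three operator tensors, below which `A` is added. -/
theorem Proportional.comp_act {o : Type*} [Fintype o] [DecidableEq o] {q : Type*} {r : ℕ}
    {T : Fin d × Fin d → Matrix l l ℂ}
    {S : Fin d × Fin d → Matrix m m ℂ} {U : Fin d × Fin d → Matrix o o ℂ} {c : ℂ}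
    {Q Q' : Matrix (l × m × o) q ℂ}
    (h : Proportional r (compTensor T (compTensor S U)) c Q Q') (A : Fin d → Matrix n n ℂ) :
    Proportional r (actTensor T (actTensor S (actTensor U A))) c
      ((Q ⊗ₖ (1 : Matrix n n ℂ)).submatrix (fun x => ((x.1, x.2.1, x.2.2.1), x.2.2.2)) id)
      ((Q' ⊗ₖ (1 : Matrix n n ℂ)).submatrix (fun x => ((x.1, x.2.1, x.2.2.1), x.2.2.2)) id) := by
  let e : l × m × o × n ≃ (l × m × o) × n :=
    { toFun := fun x => ((x.1, x.2.1, x.2.2.1), x.2.2.2)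
      invFun := fun x => (x.1.1, x.1.2.1, x.1.2.2, x.2)
      left_inv := fun _ => rfl
      right_inv := fun _ => rfl }
  have hB : actTensor T (actTensor S (actTensor U A)) = fun i =>
      (actTensor (compTensor T (compTensor S U)) A i).submatrix e e := by
    ext i ⟨a, b, c, x⟩ ⟨a', b', c', x'⟩
    rw [funext (actTensor_actTensor S U A)]
    have := actTensor_actTensor T (compTensor S U) A i
    have h2 := congrFun (congrFun this (a, (b, c), x)) (a', (b', c'), x')
    simp only [actTensor, Matrix.sum_apply, Matrix.kronecker_apply, Matrix.submatrix_apply,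
      Equiv.prodAssoc_symm_apply] at h2 ⊢
    exact h2
  rw [hB]
  exact (h.layer_top _ _ A).submatrix e

end Acting

/-! ### Interchange of fusions and actions in a stack -/

section Fusing

theorem word_triple {κ m : Type*} [Fintype m] [DecidableEq m] (A : κ → Matrix m m ℂ)
    (i j k : κ) : word A [i, j, k] = A i * A j * A k := by
  simp [mul_assoc]

theorem one_kronecker_mul {l m n p : Type*} [Fintype l] [DecidableEq l] [Fintype n]
    (X : Matrix m n ℂ) (Y : Matrix n p ℂ) :
    (1 : Matrix l l ℂ) ⊗ₖ (X * Y) = ((1 : Matrix l l ℂ) ⊗ₖ X) * ((1 : Matrix l l ℂ) ⊗ₖ Y) := by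
  rw [← Matrix.mul_kronecker_mul, Matrix.one_mul]

section

variable {l m n p q : Type*} [Fintype l] [DecidableEq l] [Fintype m] [DecidableEq m]
  [Fintype n] [DecidableEq n] [Fintype p] [DecidableEq p] [Fintype q] [DecidableEq q]

/-- Fusing two layers commutes with acting below them. -/
theorem fuseRight_mul_one_kronecker (V : Matrix (l × m) p ℂ) (W : Matrix n q ℂ) :
    fuseRight n V * ((1 : Matrix p p ℂ) ⊗ₖ W) =
      ((1 : Matrix l l ℂ) ⊗ₖ ((1 : Matrix m m ℂ) ⊗ₖ W)) * fuseRight q V := by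
  have h1 : fuseRight n V * ((1 : Matrix p p ℂ) ⊗ₖ W) =
      (V ⊗ₖ W).submatrix (Equiv.prodAssoc l m n).symm id := by
    rw [fuseRight, ← Matrix.submatrix_id_id ((1 : Matrix p p ℂ) ⊗ₖ W),
      ← Matrix.submatrix_mul _ _ _ id _ Function.bijective_id, ← Matrix.mul_kronecker_mul,
      Matrix.mul_one, Matrix.one_mul]
  have h2 : (1 : Matrix l l ℂ) ⊗ₖ ((1 : Matrix m m ℂ) ⊗ₖ W) =
      ((1 : Matrix (l × m) (l × m) ℂ) ⊗ₖ W).submatrix (Equiv.prodAssoc l m n).symm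
        (Equiv.prodAssoc l m q).symm := by
    ext ⟨a, b, c⟩ ⟨a', b', c'⟩
    simp only [Matrix.submatrix_apply, Matrix.kronecker_apply, Matrix.one_apply,
      Equiv.prodAssoc_symm_apply, Prod.mk.injEq, ite_and]
    split_ifs <;> simp
  rw [h1, h2, fuseRight, Matrix.submatrix_mul_equiv, ← Matrix.mul_kronecker_mul,
    Matrix.mul_one, Matrix.one_mul]

end

section

variable {k l m n o p : Type*} [DecidableEq k] [Fintype k] [Fintype p]

/-- This and the next lemma express the two ways of fusing three operator tensors, with an inert
layer added below, as successive fusions in the four-layer stack. In this form the comparison by `F`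
can be chained with the L-symbols. -/
theorem fuseRight_kronecker_one [Fintype n] [DecidableEq n] (V : Matrix (l × m) p ℂ)
    (V' : Matrix (p × n) o ℂ) :
    ((fuseRight n V * V') ⊗ₖ (1 : Matrix k k ℂ)).submatrix
        (fun x : l × m × n × k => ((x.1, x.2.1, x.2.2.1), x.2.2.2)) id =
      fuseRight (n × k) V * fuseRight k V' := by
  ext ⟨a, b, c, x⟩ ⟨o, x'⟩
  simp [fuseRight, Matrix.mul_apply, Fintype.sum_prod_type, Matrix.one_apply, Prod.ext_iff,
    ite_and]

theorem one_fuse_kronecker_one [Fintype l] [DecidableEq l] (V : Matrix (m × n) p ℂ)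
    (V' : Matrix (l × p) o ℂ) :
    ((((1 : Matrix l l ℂ) ⊗ₖ V) * V') ⊗ₖ (1 : Matrix k k ℂ)).submatrix
        (fun x : l × m × n × k => ((x.1, x.2.1, x.2.2.1), x.2.2.2)) id =
      ((1 : Matrix l l ℂ) ⊗ₖ fuseRight k V) * fuseRight k V' := by
  ext ⟨a, b, c, x⟩ ⟨o, x'⟩
  simp [fuseRight, Matrix.mul_apply, Fintype.sum_prod_type, Matrix.one_apply]

end

end Fusing

/-! ### L-symbols and the coupled pentagon equation -/

section Symbols

variable {G I : Type*} [Group G] [MulAction G I] {S : System G I}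

theorem System.d_pos (S : System G I) (x : I) : 0 < S.d := by
  by_contra h
  obtain ⟨C, hC⟩ := S.A_injective x
  have : IsEmpty (Fin S.d) := ⟨fun i => h (by have := i.2; omega)⟩
  have := hC ⟨0, S.D_pos x⟩ ⟨0, S.D_pos x⟩ ⟨0, S.D_pos x⟩ ⟨0, S.D_pos x⟩
  simp at this

/-- With bond dimension zero the operator would vanish, which a unitary on a non-trivial space
cannot. The label `x` only serves to make the local dimension positive. -/
theorem System.χ_pos (S : System G I) (x : I) (g : G) : 0 < S.χ g := by
  by_contra h
  have h0 : IsEmpty (Fin (S.χ g)) := ⟨fun i => h (by have := i.2; omega)⟩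
  have h1 := (Matrix.mem_unitaryGroup_iff.1 (S.unitary g 1 le_rfl))
  have h2 : mpo (S.T g) 1 = 0 := by
    ext s t
    simp [mpo, Matrix.trace]
  rw [h2, zero_mul] at h1
  have := congrFun (congrFun h1 fun _ => ⟨0, S.d_pos x⟩) fun _ => ⟨0, S.d_pos x⟩
  simp at this

/-- `V_{a,b}`, where the label of the product is any `p = a b`. -/
def FusionRight.to (V : FusionRight S) {a b p : G} (h : a * b = p) :
    Matrix (Fin (S.χ a) × Fin (S.χ b)) (Fin (S.χ p)) ℂ :=
  (V a b).submatrix id (Fin.cast (congrArg S.χ h).symm)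

def FusionLeft.to (V : FusionLeft S) {a b p : G} (h : a * b = p) :
    Matrix (Fin (S.χ p)) (Fin (S.χ a) × Fin (S.χ b)) ℂ :=
  (V a b).submatrix (Fin.cast (congrArg S.χ h).symm) id

/-- `W_{a,x}`, where the label of the resulting state is any `z = a x`. -/
def ActionRight.to (W : ActionRight S) {a : G} {x z : I} (h : a • x = z) :
    Matrix (Fin (S.χ a) × Fin (S.D x)) (Fin (S.D z)) ℂ :=
  (W a x).submatrix id (Fin.cast (congrArg S.D h).symm)

def ActionLeft.to (W : ActionLeft S) {a : G} {x z : I} (h : a • x = z) :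
    Matrix (Fin (S.D z)) (Fin (S.χ a) × Fin (S.D x)) ℂ :=
  (W a x).submatrix (Fin.cast (congrArg S.D h).symm) id

variable {V : FusionRight S} {Vhat : FusionLeft S} {W : ActionRight S} {What : ActionLeft S}

theorem IsFusion.reducesAt (hV : IsFusion S V Vhat) {a b p : G} (h : a * b = p) :
    ReducesAt 1 (compTensor (S.T a) (S.T b)) (S.T p) (Vhat.to h) (V.to h) := by
  subst h
  exact (hV a b).reducesAt

theorem IsAction.reducesAt (hW : IsAction S W What) {a : G} {x z : I} (h : a • x = z) :
    ReducesAt 1 (actTensor (S.T a) (S.A x)) (S.A z) (What.to h) (W.to h) := by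
  subst h
  exact (hW a x).reducesAt

section

variable {a b p : G} {x y z : I}

theorem reducesAt_fuse_act (hV : IsFusion S V Vhat) (hW : IsAction S W What) (h : a * b = p)
    (hz : p • x = z) :
    ReducesAt 3 (actTensor (S.T a) (actTensor (S.T b) (S.A x))) (S.A z)
      (What.to hz * fuseLeft (Fin (S.D x)) (Vhat.to h)) (fuseRight (Fin (S.D x)) (V.to h) * W.to hz) :=
  ((hV.reducesAt h).fuse_act (S.A x)).trans (hW.reducesAt hz) le_rfl (by norm_num)

theorem reducesAt_act_act (hW : IsAction S W What) (hy : b • x = y) (hz : a • y = z) :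
    ReducesAt 3 (actTensor (S.T a) (actTensor (S.T b) (S.A x))) (S.A z)
      (What.to hz * ((1 : Matrix (Fin (S.χ a)) (Fin (S.χ a)) ℂ) ⊗ₖ What.to hy))
      (((1 : Matrix (Fin (S.χ a)) (Fin (S.χ a)) ℂ) ⊗ₖ W.to hy) * W.to hz) :=
  ((hW.reducesAt hy).layer_bot _ _ (S.T a)).trans (hW.reducesAt hz) le_rfl (by norm_num)

end

/-- Three sites are what `ReducesAt.trans` asks for when two one-site reductions are composed. The
free labels `p`, `x`, `y`, `z` absorb the casts between equal but not definitionally equal products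
and states. -/
theorem isLSymbol_iff {L : G → G → I → ℂˣ} : IsLSymbol S V W L ↔
    ∀ (a b p : G) (x y z : I) (h : a * b = p) (hz : p • x = z) (hy : b • x = y)
      (hz' : a • y = z), Proportional 3 (actTensor (S.T a) (actTensor (S.T b) (S.A x)))
        (L a b x : ℂ) (fuseRight (Fin (S.D x)) (V.to h) * W.to hz)
        (((1 : Matrix (Fin (S.χ a)) (Fin (S.χ a)) ℂ) ⊗ₖ W.to hy) * W.to hz') := by
  constructor
  · intro hL a b p x y z h hz hy hz'
    subst h hy hz'
    refine Proportional.of_length_eq fun u hu => ?_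
    obtain ⟨i, j, k, rfl⟩ := List.length_eq_three.1 hu
    rw [word_triple]
    exact hL a b x i j k
  · intro hL a b x i j k
    have := hL a b (a * b) x _ _ rfl (mul_smul a b x) rfl rfl [i, j, k] le_rfl
    rw [word_triple] at this
    exact this

theorem exists_isLSymbol (hV : IsFusion S V Vhat) (hW : IsAction S W What) :
    ∃ L, IsLSymbol S V W L := by
  have h := fun a b x => ReducesAt.exists_proportional (S.D_pos (a • b • x))
    (S.A_injective (a • b • x)) (reducesAt_fuse_act hV hW rfl (mul_smul a b x))
    (reducesAt_act_act hW rfl rfl)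
  choose L hL _ using h
  refine ⟨L, isLSymbol_iff.2 fun a b p x y z h hz hy hz' => ?_⟩
  subst h hy hz'
  exact hL a b x

theorem IsLSymbol.unique (hW : IsAction S W What) {L L' : G → G → I → ℂˣ}
    (h : IsLSymbol S V W L) (h' : IsLSymbol S V W L') : L = L' := by
  ext a b x
  exact Proportional.unique (S.D_pos _) (S.A_injective _) (reducesAt_act_act hW rfl rfl).word_eq
    (isLSymbol_iff.1 h a b _ x _ _ rfl (mul_smul a b x) rfl rfl)
    (isLSymbol_iff.1 h' a b _ x _ _ rfl (mul_smul a b x) rfl rfl)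

/-- The left tensors are related by the inverse factor. -/
theorem IsLSymbol.left (hV : IsFusion S V Vhat) (hW : IsAction S W What)
    {L : G → G → I → ℂˣ} (hL : IsLSymbol S V W L) {a b p : G} {x y z : I} (h : a * b = p)
    (hz : p • x = z) (hy : b • x = y) (hz' : a • y = z) (v : List (Fin S.d))
    (hv : 3 ≤ v.length) :
    What.to hz' * ((1 : Matrix (Fin (S.χ a)) (Fin (S.χ a)) ℂ) ⊗ₖ What.to hy) *
        word (actTensor (S.T a) (actTensor (S.T b) (S.A x))) v =
      (L a b x : ℂ) • (What.to hz * fuseLeft (Fin (S.D x)) (Vhat.to h) *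
        word (actTensor (S.T a) (actTensor (S.T b) (S.A x))) v) := by
  obtain ⟨c, hc, hc'⟩ := ReducesAt.exists_proportional (S.D_pos z) (S.A_injective z)
    (reducesAt_fuse_act hV hW h hz) (reducesAt_act_act hW hy hz')
  have : (c : ℂ) = L a b x := Proportional.unique (S.D_pos _) (S.A_injective _)
    (reducesAt_act_act hW hy hz').word_eq hc (isLSymbol_iff.1 hL a b p x y z h hz hy hz')
  rw [← this]
  exact hc' v hv

/-- The coupled pentagon equation, up to a factor (the `F`-symbol) that does not depend on the
ground state. -/
theorem IsLSymbol.pentagon (hV : IsFusion S V Vhat) (hW : IsAction S W What)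
    {L : G → G → I → ℂˣ} (hL : IsLSymbol S V W L) (a b c : G) :
    ∃ F : ℂˣ, ∀ x, L (a * b) c x * L a b (c • x) = F * L a (b * c) x * L b c x := by
  rcases isEmpty_or_nonempty I with hI | ⟨⟨x₀⟩⟩
  · exact ⟨1, fun x => isEmptyElim x⟩
  have e1 : a * b * c = a * b * c := rfl
  have e2 : a * (b * c) = a * b * c := (mul_assoc a b c).symm
  -- `F` comes from the operator tensors alone and is fixed before `x` is introduced; this is why it
  -- can cancel later.
  obtain ⟨F, hF, -⟩ := ReducesAt.exists_proportional (S.χ_pos x₀ (a * b * c))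
    (S.T_injective (a * b * c))
    (((hV.reducesAt (rfl : a * b = a * b)).fuse_comp (S.T c)).trans (hV.reducesAt e1)
      le_rfl (by norm_num : 1 + 1 ≤ 3))
    (((hV.reducesAt (rfl : b * c = b * c)).layer_bot _ _ (S.T a)).trans (hV.reducesAt e2)
      le_rfl (by norm_num : 1 + 1 ≤ 3))
  refine ⟨F, fun x => ?_⟩
  rw [isLSymbol_iff] at hL
  have ez : (a * b * c) • x = a • b • c • x := by simp [mul_smul]
  have ew : (b * c) • x = b • c • x := mul_smul _ _ _
  have ev : (a * b) • c • x = a • b • c • x := mul_smul _ _ _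
  -- The five moves of the pentagon: `p1`, `p2` along one path, `p3`, `p4`, `p5` along the other.
  -- Six sites suffice for all of them and are not optimal.
  have p1 := (hL (a * b) c _ x _ _ e1 ez rfl ev).mul_left
    ((hV.reducesAt (rfl : a * b = a * b)).fuse_act (actTensor (S.T c) (S.A x))) 
    (t := 6) (by norm_num) (by norm_num)
  have p2 := (hL a b (a * b) (c • x) _ _ rfl ev rfl rfl).mul_left
    (((hW.reducesAt (rfl : c • x = c • x)).layer_bot _ _ (S.T b)).layer_bot _ _ (S.T a))
    (t := 6) (by norm_num) (by norm_num)
  have p3 := ((hF.comp_act (S.A x)).mul_right (W.to ez)).mono (by norm_num : 3 ≤ 6)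
  have p4 := (hL a (b * c) _ x _ _ e2 ez ew rfl).mul_left
    (((hV.reducesAt (rfl : b * c = b * c)).fuse_act (S.A x)).layer_bot _ _ (S.T a))
    (t := 6) (by norm_num) (by norm_num)
  have p5 := (hL b c _ x _ _ rfl ew rfl rfl).layer_bot (fun i j => (i, j)) (fun _ j => j)
    (S.T a)
  replace p5 := (p5.mul_right (W.to (rfl : a • b • c • x = a • b • c • x))).mono
    (by norm_num : 3 ≤ 6)
  rw [← Matrix.mul_assoc _ _ (W.to ev), fuseRight_mul_one_kronecker] at p1
  rw [fuseRight_kronecker_one, one_fuse_kronecker_one] at p3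
  rw [one_kronecker_mul, one_kronecker_mul] at p5
  simp only [Matrix.mul_assoc] at p1 p2 p3 p4 p5
  -- Both paths end at the three successive actions. These belong to a reduction to an injective
  -- tensor, so the accumulated factors can be compared.
  have h0 := ((reducesAt_act_act hW (rfl : c • x = c • x)
    (rfl : b • c • x = b • c • x)).layer_bot (fun i j => (i, j)) (fun _ j => j) (S.T a)).trans
    (hW.reducesAt (rfl : a • b • c • x = a • b • c • x)) (t := 7) (by norm_num) (by norm_num)
  simp only [one_kronecker_mul, Matrix.mul_assoc] at h0
  have q1 := p1.trans p2
  have q2 := p3.trans (p4.trans p5)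
  have h := Proportional.unique (S.D_pos _) (S.A_injective _) h0.word_eq q1 q2
  ext
  push_cast
  rw [h]
  ring

end Symbols

/-! ### Cocycle condition, rescaling and normalization -/

section Gauge

variable {G I : Type*} [Group G] [MulAction G I] {S : System G I}
  {V : FusionRight S} {Vhat : FusionLeft S} {W : ActionRight S} {What : ActionLeft S}

theorem smul_eq_of_unbroken (h : unbroken G I) (x : I) : (h : G) • x = x :=
  h.2 ⟨x, Set.mem_univ x⟩

theorem IsLSymbol.isTwoCocycle (hV : IsFusion S V Vhat) (hW : IsAction S W What)
    {L : G → G → I → ℂˣ} (hL : IsLSymbol S V W L) (y x : I) :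
    IsTwoCocycle (wallFactor L y x) := by
  intro h₁ h₂ h₃
  obtain ⟨F, hF⟩ := hL.pentagon hV hW (h₁ : G) h₂ h₃
  have hx := hF x
  have hy := hF y
  rw [smul_eq_of_unbroken] at hx hy
  simp only [wallFactor, Subgroup.coe_mul]
  -- The same `F` appears in numerator and denominator and drops out.
  rw [div_mul_div_comm, div_mul_div_comm, mul_comm (L h₁ h₂ y), mul_comm (L h₁ h₂ x), hx, hy,
    mul_assoc, mul_assoc, mul_div_mul_left_eq_div]

theorem IsReduction.smul {κ m : Type*} [Fintype m] [DecidableEq m] {n : ℕ}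
    {B : κ → Matrix m m ℂ} {A : κ → Matrix (Fin n) (Fin n) ℂ} {P : Matrix (Fin n) m ℂ}
    {Q : Matrix m (Fin n) ℂ} (h : IsReduction B A P Q) {c : ℂ} (hc : c ≠ 0) :
    IsReduction B A (c⁻¹ • P) (c • Q) := by
  refine ⟨fun l => ?_, fun i k l hl => ?_⟩
  · simpa [smul_smul, hc] using h.1 l
  · simpa [smul_smul, hc] using h.2 i k l hl

theorem IsFusion.smul (hV : IsFusion S V Vhat) (β : G → G → ℂˣ) :
    IsFusion S (fun g h => (β g h : ℂ) • V g h) (fun g h => (β g h : ℂ)⁻¹ • Vhat g h) :=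
  fun g h => (hV g h).smul (β g h).ne_zero

theorem IsAction.smul (hW : IsAction S W What) (γ : G → I → ℂˣ) :
    IsAction S (fun g x => (γ g x : ℂ) • W g x) (fun g x => (γ g x : ℂ)⁻¹ • What g x) :=
  fun g x => (hW g x).smul (γ g x).ne_zero

theorem IsLSymbol.smul {L : G → G → I → ℂˣ} (hL : IsLSymbol S V W L) (β : G → G → ℂˣ)
    (γ : G → I → ℂˣ) :
    IsLSymbol S (fun g h => (β g h : ℂ) • V g h) (fun g x => (γ g x : ℂ) • W g x)
      (fun g h x => L g h x * (β g h * γ (g * h) x / (γ h x * γ g (h • x)))) := by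
  intro g h x i j k
  have e1 : fuseThenAct S (fun g h => (β g h : ℂ) • V g h) (fun g x => (γ g x : ℂ) • W g x) g h x =
      ((β g h : ℂ) * γ (g * h) x) • fuseThenAct S V W g h x := by
    simp [fuseThenAct, Matrix.smul_kronecker, Matrix.submatrix_smul, smul_smul, mul_comm]
  have e2 : actTwice S (fun g x => (γ g x : ℂ) • W g x) g h x =
      ((γ h x : ℂ) * γ g (h • x)) • actTwice S W g h x := by
    simp [actTwice, Matrix.kronecker_smul, smul_smul, mul_comm]
  have := hL g h x i j k
  simp only at this ⊢
  rw [e1, e2, Matrix.mul_smul, this, Matrix.mul_smul, smul_smul (M := ℂ),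
    smul_smul (M := ℂ)]
  congr 1
  have h1 := (γ h x).ne_zero
  have h2 := (γ g (h • x)).ne_zero
  push_cast
  field_simp

theorem IsLSymbol.wallFactor_smul (hW : IsAction S W What) {L : G → G → I → ℂˣ}
    (hL : IsLSymbol S V W L) {β : G → G → ℂˣ} {γ : G → I → ℂˣ} {L' : G → G → I → ℂˣ}
    (hL' : IsLSymbol S (fun g h => (β g h : ℂ) • V g h) (fun g x => (γ g x : ℂ) • W g x) L')
    (y x : I) (h₁ h₂ : unbroken G I) :
    wallFactor L y x h₁ h₂ = wallFactor L' y x h₁ h₂ *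
      ((γ h₁ y / γ h₁ x) * (γ h₂ y / γ h₂ x) / (γ (h₁ * h₂ : G) y / γ (h₁ * h₂ : G) x)) := by
  rw [hL'.unique (hW.smul γ) (hL.smul β γ)]
  simp only [wallFactor, smul_eq_of_unbroken]
  ext
  push_cast
  have n1 := (L h₁ h₂ x).ne_zero
  have n2 := (γ h₁ x).ne_zero
  have n3 := (γ h₂ x).ne_zero
  have n4 := (γ h₁ y).ne_zero
  have n5 := (γ h₂ y).ne_zero
  have n6 := (γ (h₁ * h₂ : G) y).ne_zero
  have n7 := (γ (h₁ * h₂ : G) x).ne_zero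
  have n8 := (β h₁ h₂).ne_zero
  field_simp

/-- A real solution of the coupled pentagon equation is trivial. -/
theorem exists_trivialization {G I : Type*} [Group G] [Fintype G] [MulAction G I] [Fintype I]
    [Nonempty I] (l : G → G → I → ℝ)
    (hl : ∀ a b c, ∃ F, ∀ x, l (a * b) c x + l a b (c • x) = F + l a (b * c) x + l b c x) :
    ∃ (β : G → G → ℝ) (γ : G → I → ℝ), ∀ a b x,
      l a b x + β a b + γ (a * b) x - γ b x - γ a (b • x) = 0 := by
  have hI : (Fintype.card I : ℝ) ≠ 0 := by exact_mod_cast Fintype.card_ne_zero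
  have hG : (Fintype.card G : ℝ) ≠ 0 := by exact_mod_cast Fintype.card_ne_zero
  -- Subtracting the mean over ground states removes `F`: the mean of the pentagon equation
  -- expresses `F` by the means of `l`, since `c` only permutes the labels.
  let β (a b : G) : ℝ := -((∑ x, l a b x) / Fintype.card I)
  have h1 : ∀ a b c x, (l (a * b) c x + β (a * b) c) + (l a b (c • x) + β a b) =
      (l a (b * c) x + β a (b * c)) + (l b c x + β b c) := by
    intro a b c x
    obtain ⟨F, hF⟩ := hl a b c
    have hs := Finset.sum_congr (rfl : (Finset.univ : Finset I) = Finset.univ) fun x _ => hF x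
    have hc : ∑ x, l a b (c • x) = ∑ x, l a b x :=
      Equiv.sum_comp (MulAction.toPerm c) (l a b)
    simp only [Finset.sum_add_distrib, hc, Finset.sum_const, Finset.card_univ,
      nsmul_eq_mul] at hs
    have hx := hF x
    simp only [β]
    field_simp
    linear_combination (Fintype.card I : ℝ) * hx - hs
  -- The mean over the first group argument. Summing `h1` over `a` and translating by `b` exhibits
  -- the corrected `l` as a combination of such means.
  let γ (b : G) (x : I) : ℝ := (∑ a, (l a b x + β a b)) / Fintype.card G
  refine ⟨β, γ, fun b c x => ?_⟩
  have hs := Finset.sum_congr (rfl : (Finset.univ : Finset G) = Finset.univ)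
    fun a _ => h1 a b c x
  have hc : ∑ a, (l (a * b) c x + β (a * b) c) = ∑ a, (l a c x + β a c) :=
    Equiv.sum_comp (Equiv.mulRight b) fun a => l a c x + β a c
  rw [Finset.sum_add_distrib (f := fun a => l (a * b) c x + β (a * b) c), hc,
    Finset.sum_add_distrib (g := fun _ => l b c x + β b c), Finset.sum_const, Finset.card_univ,
    nsmul_eq_mul] at hs
  simp only [γ]
  field_simp
  linear_combination -hs

theorem IsLSymbol.exists_norm_eq_one [Finite G] (hV : IsFusion S V Vhat)
    (hW : IsAction S W What) {L : G → G → I → ℂˣ} (hL : IsLSymbol S V W L) :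
    ∃ (β : G → G → ℂˣ) (γ : G → I → ℂˣ) (L' : G → G → I → ℂˣ),
      IsLSymbol S (fun g h => (β g h : ℂ) • V g h) (fun g x => (γ g x : ℂ) • W g x) L' ∧
      ∀ g h x, ‖(L' g h x : ℂ)‖ = 1 := by
  rcases isEmpty_or_nonempty I with hI | ⟨⟨x₀⟩⟩
  · exact ⟨1, 1, _, hL.smul 1 1, fun _ _ x => isEmptyElim x⟩
  have : Nonempty I := ⟨x₀⟩
  have : Finite I := Finite.of_surjective (fun g : G => g • x₀) fun x =>
    S.transitive.exists_smul_eq x₀ x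
  cases nonempty_fintype G
  cases nonempty_fintype I
  obtain ⟨β, γ, h⟩ := exists_trivialization (fun a b (x : I) => Real.log ‖(L a b x : ℂ)‖) (by
    intro a b c
    obtain ⟨F, hF⟩ := hL.pentagon hV hW a b c
    refine ⟨Real.log ‖(F : ℂ)‖, fun x => ?_⟩
    have := congrArg (fun u : ℂˣ => Real.log ‖(u : ℂ)‖) (hF x)
    simp only [Units.val_mul, norm_mul] at this
    rwa [Real.log_mul (by simp) (by simp), Real.log_mul (by simp) (by simp),
      Real.log_mul (by simp) (by simp)] at this)
  let u (r : ℝ) : ℂˣ := Units.mk0 (Complex.exp r) (Complex.exp_ne_zero _)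
  refine ⟨fun a b => u (β a b), fun a x => u (γ a x), _, hL.smul _ _, fun a b x => ?_⟩
  have hpos : 0 < ‖(L a b x : ℂ)‖ := norm_pos_iff.2 (L a b x).ne_zero
  have h0 := congrArg Real.exp (h a b x)
  simp only [Real.exp_sub, Real.exp_add, Real.exp_log hpos, Real.exp_zero] at h0
  simp only [u, Units.val_mul, Units.val_div_eq_div_val, Units.val_mk0, norm_mul, norm_div,
    Complex.norm_exp_ofReal]
  rw [← h0]
  ring

end Gauge

/-! ### Rings with two marked sites -/

section Configurations

variable {α : Type*}

theorem ofFn_add_two {a b : ℕ} (f : Fin (a + b + 2) → α) :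
    List.ofFn f = f ⟨0, by omega⟩ :: (List.ofFn (fun k : Fin a => f ⟨k.1 + 1, by omega⟩) ++
      f ⟨a + 1, by omega⟩ :: List.ofFn fun k : Fin b => f ⟨a + 2 + k.1, by omega⟩) := by
  apply List.ext_getElem
  · simp; omega
  · intro i h1 h2
    simp only [List.getElem_cons, List.getElem_append, List.getElem_ofFn, List.length_ofFn]
    split_ifs <;> congr 1 <;> ext <;> simp <;> omega

/-- A configuration on a ring with two marked sites, from its four parts. -/
def wallConfig {a b : ℕ} (j : α) (u : Fin a → α) (j' : α) (v : Fin b → α) :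
    Fin (a + b + 2) → α := fun i =>
  if h₀ : i.1 = 0 then j else if h : i.1 - 1 < a then u ⟨i.1 - 1, h⟩ else
    if h' : i.1 = a + 1 then j' else v ⟨i.1 - (a + 2), by omega⟩

section

variable {a b : ℕ} (j : α) (u : Fin a → α) (j' : α) (v : Fin b → α)

@[simp] theorem wallConfig_zero (h : 0 < a + b + 2) : wallConfig j u j' v ⟨0, h⟩ = j := rfl

@[simp] theorem wallConfig_left (k : Fin a) (h : k.1 + 1 < a + b + 2) :
    wallConfig j u j' v ⟨k.1 + 1, h⟩ = u k := by
  simp [wallConfig]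

@[simp] theorem wallConfig_mid (h : a + 1 < a + b + 2) :
    wallConfig j u j' v ⟨a + 1, h⟩ = j' := by
  simp [wallConfig]

@[simp] theorem wallConfig_right (k : Fin b) (h : a + 2 + k.1 < a + b + 2) :
    wallConfig j u j' v ⟨a + 2 + k.1, h⟩ = v k := by
  simp only [wallConfig]
  rw [dif_neg (by omega), dif_neg (by omega), dif_neg (by omega)]
  congr 1
  ext
  simp

end

/-- Splitting a configuration on a ring at two marked sites. -/
def wallEquiv (a b : ℕ) : (Fin (a + b + 2) → α) ≃ α × (Fin a → α) × α × (Fin b → α) where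
  toFun s := (s ⟨0, by omega⟩, fun k => s ⟨k.1 + 1, by omega⟩, s ⟨a + 1, by omega⟩,
    fun k => s ⟨a + 2 + k.1, by omega⟩)
  invFun p := wallConfig p.1 p.2.1 p.2.2.1 p.2.2.2
  left_inv s := by
    ext i
    simp only [wallConfig]
    split_ifs <;> refine congrArg s (Fin.ext ?_) <;> simp only <;> omega
  right_inv p := by
    obtain ⟨j, u, j', v⟩ := p
    simp only [wallConfig_zero, wallConfig_left, wallConfig_mid, wallConfig_right]

end Configurations

/-! ### Matrix product operators acting on a ring with two walls -/

section Walls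

variable {d : ℕ} {l m n n' : Type*} [Fintype l] [DecidableEq l] [Fintype m] [DecidableEq m]
  [Fintype n] [DecidableEq n] [Fintype n'] [DecidableEq n']

theorem word_actTensor_ofFn (T : Fin d × Fin d → Matrix m m ℂ) (A : Fin d → Matrix n n ℂ) {a : ℕ}
    (s : Fin a → Fin d) :
    word (actTensor T A) (List.ofFn s) = ∑ t : Fin a → Fin d,
      word T (List.ofFn fun k => (s k, t k)) ⊗ₖ word A (List.ofFn t) := by
  rw [actTensor_eq_layer, word_layer]
  refine Fintype.sum_equiv
    ((finCongr (List.length_ofFn (f := s))).arrowCongr (Equiv.refl (Fin d))) _ _ fun t => ?_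
  congr 2 <;>
  · apply List.ext_getElem
    · simp [legs]
    · intro i h1 h2
      simp [legs, finCongr]

/-- The image of a ring with two walls under a matrix product operator. -/
theorem sum_mpo_mul_trace {n : ℕ} (T : Fin d × Fin d → Matrix (Fin n) (Fin n) ℂ)
    (E : Fin d → Matrix m n' ℂ) (A' : Fin d → Matrix n' n' ℂ) (E' : Fin d → Matrix n' m ℂ)
    (A : Fin d → Matrix m m ℂ) {a b : ℕ} (j j' : Fin d) (u : Fin a → Fin d) (v : Fin b → Fin d) :
    ∑ t : Fin (a + b + 2) → Fin d, mpo T (a + b + 2) (wallConfig j u j' v) t *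
        (E (t ⟨0, by omega⟩) * word A' (List.ofFn fun k : Fin a => t ⟨k.1 + 1, by omega⟩) *
          E' (t ⟨a + 1, by omega⟩) *
          word A (List.ofFn fun k : Fin b => t ⟨a + 2 + k.1, by omega⟩)).trace =
      (actTensor T E j * word (actTensor T A') (List.ofFn u) * actTensor T E' j' *
        word (actTensor T A) (List.ofFn v)).trace := by
  rw [← (wallEquiv a b).symm.sum_comp, word_actTensor_ofFn, word_actTensor_ofFn]
  -- A product of traces is the trace of the Kronecker product, so each term of the acted ring
  -- splits into an operator entry times a wall coefficient.
  simp only [actTensor, Matrix.sum_mul, Matrix.mul_sum, ← Matrix.mul_kronecker_mul,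
    Matrix.trace_sum, Matrix.trace_kronecker, Fintype.sum_prod_type]
  simp only [← Fintype.sum_prod_type']
  refine Fintype.sum_equiv
    { toFun := fun p => (p.2.2.2, p.2.2.1, p.2.1, p.1)
      invFun := fun p => (p.2.2.2, p.2.2.1, p.2.1, p.1)
      left_inv := fun _ => rfl
      right_inv := fun _ => rfl } _ _ fun p => ?_
  simp only [wallEquiv, mpo, Matrix.of_apply, ofFn_add_two, Equiv.coe_fn_symm_mk, Equiv.coe_fn_mk,
    wallConfig_zero, wallConfig_left, wallConfig_mid, wallConfig_right, word_cons, word_append,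
    mul_assoc]

end Walls

/-! ### Opening the ring and reducing walls between injective tensors -/

section Sandwich

theorem trace_mul_single_mul_single {m n : Type*} [Fintype m] [Fintype n] [DecidableEq m]
    [DecidableEq n] (X : Matrix m n ℂ) (Y : Matrix n m ℂ) (a b : n) (c d : m) :
    (X * Matrix.single a b (1 : ℂ) * Y * Matrix.single c d (1 : ℂ)).trace = X d a * Y b c := by
  simp [Matrix.trace, Matrix.mul_apply, Matrix.single_apply, ite_and]

/-- On a ring with injective tensors in between, the traces determine the product of the two
other tensors. -/
theorem eq_of_trace_eq {κ : Type*} [Fintype κ] {n n' : ℕ}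
    {A : κ → Matrix (Fin n) (Fin n) ℂ} {A' : κ → Matrix (Fin n') (Fin n') ℂ}
    (hA : TensorInjective A) (hA' : TensorInjective A') (r : ℕ) (X X₁ : Matrix (Fin n) (Fin n') ℂ)
    (Y Y₁ : Matrix (Fin n') (Fin n) ℂ) (c : ℂ)
    (h : ∀ u v : List κ, u.length = r + 1 → v.length = r + 1 →
      (X * word A' u * Y * word A v).trace = c * (X₁ * word A' u * Y₁ * word A v).trace)
    (a a' b b') : X a a' * Y b' b = c * (X₁ a a' * Y₁ b' b) := by
  let f (X : Matrix (Fin n) (Fin n') ℂ) (Y : Matrix (Fin n') (Fin n) ℂ) :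
      Matrix (Fin n') (Fin n') ℂ →ₗ[ℂ] Matrix (Fin n) (Fin n) ℂ →ₗ[ℂ] ℂ :=
    LinearMap.mk₂ ℂ (fun U V => (X * U * Y * V).trace)
      (fun _ _ _ => by simp [Matrix.mul_add, Matrix.add_mul])
      (fun _ _ _ => by simp)
      (fun _ _ _ => by simp [Matrix.mul_add])
      (fun _ _ _ => by simp)
  have key : f X Y = c • f X₁ Y₁ := by
    refine hA'.linearMap_ext r fun u hu => hA.linearMap_ext r fun v hv => ?_
    simpa [f] using h u v hu hv
  -- Matrix units in place of the two injective stretches cut the ring into one entry of each wall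
  -- tensor.
  have := LinearMap.congr_fun (LinearMap.congr_fun key (Matrix.single a' b' 1))
    (Matrix.single b a 1)
  simpa only [f, LinearMap.smul_apply, LinearMap.mk₂_apply, trace_mul_single_mul_single,
    smul_eq_mul] using this

/-- Injective tensors on both sides of a non-zero tensor do not annihilate it. -/
theorem exists_sandwich_ne_zero {κ : Type*} [Fintype κ] {n n' : ℕ}
    {A : κ → Matrix (Fin n) (Fin n) ℂ} {A' : κ → Matrix (Fin n') (Fin n') ℂ}
    (hA : TensorInjective A) (hA' : TensorInjective A') (r : ℕ) {X : Matrix (Fin n) (Fin n') ℂ}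
    (hX : X ≠ 0) : ∃ u v : List κ, u.length = r + 1 ∧ v.length = r + 1 ∧
      word A u * X * word A' v ≠ 0 := by
  by_contra! h
  let f : Matrix (Fin n) (Fin n) ℂ →ₗ[ℂ] Matrix (Fin n') (Fin n') ℂ →ₗ[ℂ]
      Matrix (Fin n) (Fin n') ℂ :=
    LinearMap.mk₂ ℂ (fun U V => U * X * V)
      (fun _ _ _ => by simp [Matrix.add_mul])
      (fun _ _ _ => by simp)
      (fun _ _ _ => by simp [Matrix.mul_add])
      (fun _ _ _ => by simp)
  have key : f = 0 := by
    refine hA.linearMap_ext r fun u hu => hA'.linearMap_ext r fun v hv => ?_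
    simpa [f] using h u v hu hv
  have := LinearMap.congr_fun (LinearMap.congr_fun key 1) 1
  exact hX (by simpa [f] using this)

theorem exists_sandwich_three_ne_zero {κ : Type*} [Fintype κ] {n n' : ℕ}
    {A : κ → Matrix (Fin n) (Fin n) ℂ} {A' : κ → Matrix (Fin n') (Fin n') ℂ}
    (hA : TensorInjective A) (hA' : TensorInjective A') {e : κ → Matrix (Fin n) (Fin n') ℂ}
    (he : e ≠ 0) : ∃ i j k, A i * e j * A' k ≠ 0 := by
  obtain ⟨j, hj⟩ := Function.ne_iff.1 he
  obtain ⟨u, v, hu, hv, h⟩ := exists_sandwich_ne_zero hA hA' 0 hj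
  obtain ⟨i, rfl⟩ := List.length_eq_one_iff.1 hu
  obtain ⟨k, rfl⟩ := List.length_eq_one_iff.1 hv
  exact ⟨i, j, k, by simpa using h⟩

/-- A non-zero product determines its factors up to mutually inverse numbers: freeze the second
argument where `F'` does not vanish. -/
theorem exists_unit_mul_eq {α β : Type*} {f F : α → ℂ} {f' F' : β → ℂ} {c : ℂ} (hc : c ≠ 0)
    (h : ∀ q p, f q * f' p = c * (F q * F' p)) (hF : F ≠ 0) (hF' : F' ≠ 0) :
    ∃ b : ℂˣ, ∀ q, f q = b * F q := by
  obtain ⟨q, hq⟩ := Function.ne_iff.1 hF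
  obtain ⟨p, hp⟩ := Function.ne_iff.1 hF'
  have hp' : f' p ≠ 0 := fun h0 => by
    have := h q p
    rw [h0, mul_zero] at this
    exact mul_ne_zero hc (mul_ne_zero hq hp) this.symm
  refine ⟨Units.mk0 (c * F' p / f' p) (div_ne_zero (mul_ne_zero hc hp) hp'), fun q => ?_⟩
  rw [Units.val_mk0, eq_comm, div_mul_eq_mul_div, div_eq_iff hp', h]
  ring

variable {κ m m' n n' : Type*} [Fintype m] [DecidableEq m] [Fintype n] [DecidableEq n]
  [Fintype m'] [DecidableEq m'] [Fintype n'] [DecidableEq n']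

/-- If a tensor between two reductions is reduced to another one, this holds as well with more
tensors on either side. -/
theorem sandwich_word {B : κ → Matrix m m ℂ} {A : κ → Matrix n n ℂ} {P : Matrix n m ℂ}
    {Q : Matrix m n ℂ} {B' : κ → Matrix m' m' ℂ} {A' : κ → Matrix n' n' ℂ}
    {P' : Matrix n' m' ℂ} {Q' : Matrix m' n' ℂ} (h : ReducesAt 1 B A P Q)
    (h' : ReducesAt 1 B' A' P' Q') {E : Matrix m m' ℂ} {e : Matrix n n' ℂ} {b : ℂ}
    (hE : ∀ i k, P * B i * E * B' k * Q' = b • (A i * e * A' k)) {u v : List κ}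
    (hu : 3 ≤ u.length) (hv : 3 ≤ v.length) :
    P * word B u * E * word B' v * Q' = b • (word A u * e * word A' v) := by
  obtain ⟨u, i, rfl⟩ : ∃ u' i, u = u' ++ [i] :=
    ⟨_, _, (List.dropLast_append_getLast (List.ne_nil_of_length_pos (by omega))).symm⟩
  obtain ⟨k, v, rfl⟩ := List.exists_cons_of_length_pos (by omega : 0 < v.length)
  have e1 := h.absorb_left (w := u) (v := [i]) le_rfl (by simpa using hu)
  have e2 := h'.absorb_right (u := [k]) (w := v) le_rfl (by simpa using hv)
  simp only [word_cons, word_nil, mul_one] at e1 e2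
  simp only [word_append, word_cons, word_nil, mul_one]
  calc P * (word B u * B i) * E * (B' k * word B' v) * Q'
      = (P * (word B u * B i)) * E * (B' k * word B' v * Q') := by
        simp only [Matrix.mul_assoc]
    _ = word A u * (P * B i * E * B' k * Q') * word A' v := by
        rw [e1, e2]; simp only [Matrix.mul_assoc]
    _ = _ := by
        rw [hE]; simp only [Matrix.mul_assoc, Matrix.mul_smul, Matrix.smul_mul]

theorem sandwich_layer {d : ℕ} {l m m' n n' : Type*} [Fintype l] [DecidableEq l] [Fintype m]
    [Fintype m'] [Fintype n] [Fintype n']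
    (T : Fin d × Fin d → Matrix l l ℂ)
    {B : Fin d → Matrix m m ℂ} {A : Fin d → Matrix n n ℂ} {P : Matrix n m ℂ}
    {B' : Fin d → Matrix m' m' ℂ} {A' : Fin d → Matrix n' n' ℂ}
    {Q' : Matrix m' n' ℂ} {E : Fin d → Matrix m m' ℂ} {e : Fin d → Matrix n n' ℂ} {b : ℂ}
    (hE : ∀ i j k, P * B i * E j * B' k * Q' = b • (A i * e j * A' k)) (i j k : Fin d) :
    ((1 : Matrix l l ℂ) ⊗ₖ P) * actTensor T B i * actTensor T E j * actTensor T B' k *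
        ((1 : Matrix l l ℂ) ⊗ₖ Q') =
      b • (actTensor T A i * actTensor T e j * actTensor T A' k) := by
  simp only [actTensor, Matrix.sum_mul, Matrix.mul_sum, ← Matrix.mul_kronecker_mul,
    Finset.smul_sum, Matrix.one_mul, Matrix.mul_one, hE, Matrix.kronecker_smul]

theorem sandwich_fuse {d : ℕ} {l k p : Type*} [Fintype l] [DecidableEq l] [Fintype k]
    [DecidableEq k] [Fintype p] [DecidableEq p] {T : Fin d × Fin d → Matrix l l ℂ}
    {S : Fin d × Fin d → Matrix k k ℂ} {U : Fin d × Fin d → Matrix p p ℂ}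
    {P : Matrix p (l × k) ℂ} {Q : Matrix (l × k) p ℂ}
    (h : ∀ u, P * word (compTensor T S) u * Q = word U u)
    (A : Fin d → Matrix n n ℂ) (e : Fin d → Matrix n n' ℂ) (A' : Fin d → Matrix n' n' ℂ)
    (i j s : Fin d) :
    fuseLeft n P * actTensor T (actTensor S A) i * actTensor T (actTensor S e) j *
        actTensor T (actTensor S A') s * fuseRight n' Q =
      actTensor U A i * actTensor U e j * actTensor U A' s := by
  have h3 := fun i j k => h [i, j, k]
  simp only [word_triple, ← Matrix.mul_assoc] at h3
  simp only [actTensor_actTensor, fuseLeft, fuseRight, Matrix.submatrix_mul_equiv,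
    Matrix.submatrix_id_id]
  simp only [actTensor, Matrix.sum_mul, Matrix.mul_sum, ← Matrix.mul_kronecker_mul,
    Matrix.one_mul, Matrix.mul_one, h3]

end Sandwich

/-! ### Existence, uniqueness and composition of the B-phases -/

section Walls

theorem exists_ofFn_eq {α : Type*} {l : List α} {n : ℕ} (h : l.length = n) :
    ∃ f : Fin n → α, List.ofFn f = l := by
  subst h
  exact ⟨l.get, List.ofFn_get l⟩

variable {G I : Type*} [Group G] [MulAction G I] {S : System G I}
  {V : FusionRight S} {Vhat : FusionLeft S} {W : ActionRight S} {What : ActionLeft S}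
  {e : WallTensors S}

theorem mulVec_wallState (g : G) (x y : I) {a b : ℕ} (j j' : Fin S.d) (u : Fin a → Fin S.d)
    (v : Fin b → Fin S.d) :
    (mpo (S.T g) (a + b + 2)).mulVec (wallState S e x y a b) (wallConfig j u j' v) =
      (actTensor (S.T g) (e x y) j * word (actTensor (S.T g) (S.A y)) (List.ofFn u) *
        actTensor (S.T g) (e y x) j' * word (actTensor (S.T g) (S.A x)) (List.ofFn v)).trace :=
  sum_mpo_mul_trace _ _ _ _ _ _ _ _ _

theorem wallState_wallConfig (x y : I) {a b : ℕ} (j j' : Fin S.d) (u : Fin a → Fin S.d)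
    (v : Fin b → Fin S.d) :
    wallState S e x y a b (wallConfig j u j' v) = (e x y j * word (S.A y) (List.ofFn u) *
      e y x j' * word (S.A x) (List.ofFn v)).trace := by
  simp only [wallState, wallConfig_zero, wallConfig_left, wallConfig_mid, wallConfig_right]

theorem wallState_ne_zero (he : ∀ x y, e x y ≠ 0) (x y : I) (r : ℕ) :
    wallState S e x y (r + 1) (r + 1) ≠ 0 := by
  intro h0
  obtain ⟨j, hj⟩ := Function.ne_iff.1 (he x y)
  obtain ⟨j', hj'⟩ := Function.ne_iff.1 (he y x)
  -- With constant `0`, the opened ring says that all products of entries of the two wall tensors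
  -- vanish.
  have key := eq_of_trace_eq (S.A_injective x) (S.A_injective y) r (e x y j) (e x y j)
    (e y x j') (e y x j') 0 (by
      intro u v hu hv
      obtain ⟨u, rfl⟩ := exists_ofFn_eq hu
      obtain ⟨v, rfl⟩ := exists_ofFn_eq hv
      have := congrFun h0 (wallConfig j u j' v)
      rw [wallState_wallConfig] at this
      simpa using this)
  obtain ⟨a, a', h⟩ : ∃ a a', e x y j a a' ≠ 0 := by
    by_contra! h; exact hj (Matrix.ext h)
  obtain ⟨b, b', h'⟩ : ∃ b b', e y x j' b b' ≠ 0 := by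
    by_contra! h; exact hj' (Matrix.ext h)
  exact mul_ne_zero h h' (by simpa using key a a' b' b)

theorem ArePermutedWalls.exists_trace (he : ArePermutedWalls S e) (g : G) (x y : I) :
    ∃ R : ℕ, ∀ r, R ≤ r → ∃ c : ℂ, c ≠ 0 ∧ ∀ (j j' : Fin S.d) (u v : List (Fin S.d)),
      u.length = r + 1 → v.length = r + 1 →
      (actTensor (S.T g) (e x y) j * word (actTensor (S.T g) (S.A y)) u *
        actTensor (S.T g) (e y x) j' * word (actTensor (S.T g) (S.A x)) v).trace =
      c * (e (g • x) (g • y) j * word (S.A (g • y)) u * e (g • y) (g • x) j' *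
        word (S.A (g • x)) v).trace := by
  obtain ⟨R, hR⟩ := he.2 g x y
  refine ⟨R, fun r hr => ?_⟩
  obtain ⟨c, hc⟩ := hR (r + 1) (r + 1) (by omega) (by omega)
  refine ⟨c, ?_, ?_⟩
  -- A unitary cannot annihilate the wall state, which is non-zero.
  · rintro rfl
    rw [zero_smul] at hc
    have h1 := Matrix.mem_unitaryGroup_iff'.1 (S.unitary g (r + 1 + (r + 1) + 2) (by omega))
    have h2 := congrArg (star (mpo (S.T g) (r + 1 + (r + 1) + 2))).mulVec hc
    rw [Matrix.mulVec_mulVec, h1, Matrix.one_mulVec, Matrix.mulVec_zero] at h2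
    exact wallState_ne_zero he.1 x y r h2
  · intro j j' u v hu hv
    obtain ⟨u, rfl⟩ := exists_ofFn_eq hu
    obtain ⟨v, rfl⟩ := exists_ofFn_eq hv
    have := congrFun hc (wallConfig j u j' v)
    rwa [mulVec_wallState, Pi.smul_apply, wallState_wallConfig] at this

theorem ArePermutedWalls.exists_phase (hW : IsAction S W What) (he : ArePermutedWalls S e)
    (g : G) (x y : I) : ∃ b : ℂˣ, ∀ i j k,
      What g x * actTensor (S.T g) (S.A x) i * actTensor (S.T g) (e x y) j *
        actTensor (S.T g) (S.A y) k * W g y =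
      (b : ℂ) • (S.A (g • x) i * e (g • x) (g • y) j * S.A (g • y) k) := by
  obtain ⟨R, hR⟩ := he.exists_trace g x y
  -- Each stretch has `R + 3` sites: `R + 1` in the middle, and one at either end that is kept with
  -- the adjacent wall.
  obtain ⟨c, hc, h⟩ := hR (R + 2) (by omega)
  let f (x y : I) (q : Fin S.d × Fin S.d × Fin S.d) : Matrix (Fin (S.D (g • x)))
      (Fin (S.D (g • y))) ℂ :=
    What g x * actTensor (S.T g) (S.A x) q.1 * actTensor (S.T g) (e x y) q.2.1 *
        actTensor (S.T g) (S.A y) q.2.2 * W g y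
  let F (x y : I) (q : Fin S.d × Fin S.d × Fin S.d) : Matrix (Fin (S.D (g • x)))
      (Fin (S.D (g • y))) ℂ :=
    S.A (g • x) q.1 * e (g • x) (g • y) q.2.1 * S.A (g • y) q.2.2
  have key : ∀ q p, ∀ a a' b' b, f x y q a a' * f y x p b' b =
      c * (F x y q a a' * F y x p b' b) := by
    intro q p a a' b' b
    refine eq_of_trace_eq (S.A_injective (g • x)) (S.A_injective (g • y)) R _ _ _ _ c ?_ a a' b b'
    intro u v hu hv
    have h1 := h q.2.1 p.2.1 (q.2.2 :: u ++ [p.1]) (p.2.2 :: v ++ [q.1]) (by simp [hu])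
      (by simp [hv])
    -- Action tensors are inserted in both stretches, so that the ring becomes two reduced walls
    -- joined by words in the injective tensors.
    have hy := (hW g y).2 q.2.2 p.1 u (List.ne_nil_of_length_pos (by omega))
    have hx := (hW g x).2 p.2.2 q.1 v (List.ne_nil_of_length_pos (by omega))
    simp only [word_append, word_cons, word_nil, mul_one] at h1
    rw [← hx, ← hy] at h1
    simp only [← Matrix.mul_assoc] at h1
    rw [Matrix.trace_mul_comm _ (actTensor (S.T g) (S.A x) q.1),
      Matrix.trace_mul_comm _ (S.A (g • x) q.1)] at h1
    have h2 : (f x y q * word (S.A (g • y)) u * f y x p * word (S.A (g • x)) v).trace =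
        (actTensor (S.T g) (S.A x) q.1 * (actTensor (S.T g) (e x y) q.2.1 *
          actTensor (S.T g) (S.A y) q.2.2 * W g y * word (S.A (g • y)) u * f y x p *
          word (S.A (g • x)) v * What g x)).trace := by
      simp only [f, Matrix.mul_assoc]
      rw [Matrix.trace_mul_comm]
      simp only [Matrix.mul_assoc]
    rw [h2]
    simpa only [f, F, Matrix.mul_assoc] using h1
  have hF : ∀ x y, (fun q : (Fin S.d × Fin S.d × Fin S.d) × _ × _ => F x y q.1 q.2.1 q.2.2) ≠ 0 := by
    intro x y h0
    obtain ⟨i, j, k, hne⟩ := exists_sandwich_three_ne_zero (S.A_injective (g • x))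
      (S.A_injective (g • y)) (he.1 (g • x) (g • y))
    exact hne (Matrix.ext fun a b => congrFun h0 ((i, j, k), a, b))
  obtain ⟨b, hb⟩ := exists_unit_mul_eq (α := (Fin S.d × Fin S.d × Fin S.d) × _ × _)
    (β := (Fin S.d × Fin S.d × Fin S.d) × _ × _) (f := fun q => f x y q.1 q.2.1 q.2.2)
    (f' := fun q => f y x q.1 q.2.1 q.2.2) hc
    (fun q p => key q.1 p.1 q.2.1 q.2.2 p.2.1 p.2.2) (hF x y) (hF y x)
  exact ⟨b, fun i j k => Matrix.ext fun a a' => hb ((i, j, k), a, a')⟩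

theorem ArePermutedWalls.existsUnique_isWallPhase (hW : IsAction S W What)
    (he : ArePermutedWalls S e) : ∃! B : G → I → I → ℂˣ, IsWallPhase S W What e B := by
  choose B hB using he.exists_phase hW
  refine ⟨B, hB, fun B' hB' => ?_⟩
  ext g x y
  obtain ⟨i, j, k, hne⟩ := exists_sandwich_three_ne_zero (S.A_injective (g • x))
    (S.A_injective (g • y)) (he.1 (g • x) (g • y))
  exact smul_left_injective ℂ hne ((hB' g x y i j k).symm.trans (hB g x y i j k))

theorem IsWallPhase.to {B : G → I → I → ℂˣ} (hB : IsWallPhase S W What e B) {a : G}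
    {x x' y y' : I} (hx : a • x = x') (hy : a • y = y') (i j k : Fin S.d) :
    What.to hx * actTensor (S.T a) (S.A x) i * actTensor (S.T a) (e x y) j *
        actTensor (S.T a) (S.A y) k * W.to hy =
      (B a x y : ℂ) • (S.A x' i * e x' y' j * S.A y' k) := by
  subst hx hy
  exact hB a x y i j k

theorem IsWallPhase.mul (hV : IsFusion S V Vhat) (hW : IsAction S W What)
    {L : G → G → I → ℂˣ} (hL : IsLSymbol S V W L) (he : ∀ x y, e x y ≠ 0)
    {B : G → I → I → ℂˣ} (hB : IsWallPhase S W What e B) (a b : G) (y x : I) :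
    B a (b • y) (b • x) * B b y x * L a b x = L a b y * B (a * b) y x := by
  obtain ⟨j, hj⟩ := Function.ne_iff.1 (he (a • b • y) (a • b • x))
  obtain ⟨u, v, hu, hv, hne⟩ := exists_sandwich_ne_zero (S.A_injective (a • b • y))
    (S.A_injective (a • b • x)) 2 hj
  have hx := mul_smul a b x
  have hy := mul_smul a b y
  have hu3 : 3 ≤ u.length := by omega
  have hv3 : 3 ≤ v.length := by omega
  have left := hL.left hV hW rfl hy rfl rfl u hu3
  have right := isLSymbol_iff.1 hL a b _ x _ _ rfl hx rfl rfl v hv3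
  have s1 := sandwich_word ((hW.reducesAt (rfl : b • y = b • y)).layer_bot _ _ (S.T a))
    ((hW.reducesAt (rfl : b • x = b • x)).layer_bot _ _ (S.T a))
    (fun i k => sandwich_layer (S.T a) (hB.to rfl rfl) i j k) hu3 hv3
  have s2 := sandwich_word (hW.reducesAt (rfl : a • b • y = a • b • y))
    (hW.reducesAt (rfl : a • b • x = a • b • x))
    (fun i k => hB.to rfl rfl i j k) hu3 hv3
  have s3 := sandwich_word (b := 1) ((hV.reducesAt (rfl : a * b = a * b)).fuse_act (S.A y))
    ((hV.reducesAt (rfl : a * b = a * b)).fuse_act (S.A x))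
    (fun i k => by
      rw [one_smul]
      exact sandwich_fuse (hV.reducesAt rfl).word_eq (S.A y) (e y x) (S.A x) i j k) hu3 hv3
  have s4 := sandwich_word (hW.reducesAt hy) (hW.reducesAt hx)
    (fun i k => hB.to hy hx i j k) hu3 hv3
  rw [← actTensor_eq_layer, ← actTensor_eq_layer, ← actTensor_eq_layer,
    ← actTensor_eq_layer] at s1
  set My := actTensor (S.T a) (actTensor (S.T b) (S.A y))
  set Mx := actTensor (S.T a) (actTensor (S.T b) (S.A x))
  set E := actTensor (S.T a) (actTensor (S.T b) (e y x)) j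
  -- The left side acts twice while the right side fuses first. Exchanging the left tensors costs `L
  -- a b y` and gives the phase of the product `a * b`.
  have e1 : (What.to (rfl : a • b • y = a • b • y) *
      ((1 : Matrix (Fin (S.χ a)) (Fin (S.χ a)) ℂ) ⊗ₖ What.to (rfl : b • y = b • y)) *
        word My u) * E * (word Mx v * (fuseRight (Fin (S.D x)) (V.to (rfl : a * b = a * b)) *
          W.to hx)) = ((L a b y : ℂ) * B (a * b) y x) •
            (word (S.A (a • b • y)) u * e (a • b • y) (a • b • x) j *
              word (S.A (a • b • x)) v) := by
    have : What.to hy * (fuseLeft (Fin (S.D y)) (Vhat.to (rfl : a * b = a * b)) * word My u * E *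
        word Mx v * fuseRight (Fin (S.D x)) (V.to (rfl : a * b = a * b))) * W.to hx =
        (B (a * b) y x : ℂ) • (word (S.A (a • b • y)) u * e (a • b • y) (a • b • x) j *
              word (S.A (a • b • x)) v) := by
      rw [s3, one_smul, ← s4]
      simp only [Matrix.mul_assoc]
    rw [left, mul_smul, ← this]
    simp only [Matrix.mul_assoc, Matrix.smul_mul]
  -- The same expression, with the right tensors exchanged instead: this costs `L a b x` and gives
  -- the two successive phases.
  have e2 : (What.to (rfl : a • b • y = a • b • y) *
      ((1 : Matrix (Fin (S.χ a)) (Fin (S.χ a)) ℂ) ⊗ₖ What.to (rfl : b • y = b • y)) *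
        word My u) * E * (word Mx v * (fuseRight (Fin (S.D x)) (V.to (rfl : a * b = a * b)) *
          W.to hx)) = ((L a b x : ℂ) * (B b y x * B a (b • y) (b • x))) •
            (word (S.A (a • b • y)) u * e (a • b • y) (a • b • x) j *
              word (S.A (a • b • x)) v) := by
    have : What.to (rfl : a • b • y = a • b • y) *
        (((1 : Matrix (Fin (S.χ a)) (Fin (S.χ a)) ℂ) ⊗ₖ What.to (rfl : b • y = b • y)) *
          word My u * E * word Mx v *
          ((1 : Matrix (Fin (S.χ a)) (Fin (S.χ a)) ℂ) ⊗ₖ W.to (rfl : b • x = b • x))) *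
            W.to (rfl : a • b • x = a • b • x) =
        ((B b y x : ℂ) * B a (b • y) (b • x)) •
          (word (S.A (a • b • y)) u * e (a • b • y) (a • b • x) j *
              word (S.A (a • b • x)) v) := by
      rw [s1, mul_smul, ← s2]
      simp only [Matrix.mul_assoc, Matrix.smul_mul, Matrix.mul_smul]
    rw [right, mul_smul, ← this]
    simp only [Matrix.mul_assoc, Matrix.mul_smul]
  have h := smul_left_injective ℂ hne (e1.symm.trans e2)
  ext
  push_cast
  rw [h]
  ring

end Walls

/-! ### Phases on the unbroken subgroup -/

section Unbroken

variable {G I : Type*} [Group G] [MulAction G I] {S : System G I}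
  {V : FusionRight S} {Vhat : FusionLeft S} {W : ActionRight S} {What : ActionLeft S}
  {e : WallTensors S} {L : G → G → I → ℂˣ} {B : G → I → I → ℂˣ}

theorem IsWallPhase.mul_unbroken (hV : IsFusion S V Vhat) (hW : IsAction S W What)
    (hL : IsLSymbol S V W L) (he : ∀ x y, e x y ≠ 0) (hB : IsWallPhase S W What e B) (y x : I)
    (h₁ h₂ : unbroken G I) :
    B h₁ y x * B h₂ y x = wallFactor L y x h₁ h₂ * B (h₁ * h₂ : G) y x := by
  have h := hB.mul hV hW hL he (h₁ : G) h₂ y x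
  rw [smul_eq_of_unbroken, smul_eq_of_unbroken] at h
  rw [wallFactor, div_mul_eq_mul_div, eq_div_iff_mul_eq', h]

theorem norm_wallFactor (hL : ∀ g h x, ‖(L g h x : ℂ)‖ = 1) (y x : I) (h₁ h₂ : unbroken G I) :
    ‖(wallFactor L y x h₁ h₂ : ℂ)‖ = 1 := by
  simp [wallFactor, hL]

/-- A function on a finite group that is multiplicative up to phases consists of phases. -/
theorem norm_eq_one_of_projective {H : Type*} [Group H] [Finite H] {b : H → ℂˣ}
    {w : H → H → ℂˣ} (hw : ∀ h₁ h₂, ‖(w h₁ h₂ : ℂ)‖ = 1)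
    (hb : ∀ h₁ h₂, b h₁ * b h₂ = w h₁ h₂ * b (h₁ * h₂)) (h : H) : ‖(b h : ℂ)‖ = 1 := by
  have hmul : ∀ h₁ h₂, ‖(b (h₁ * h₂) : ℂ)‖ = ‖(b h₁ : ℂ)‖ * ‖(b h₂ : ℂ)‖ := fun h₁ h₂ => by
    rw [← norm_mul, ← Units.val_mul, hb, Units.val_mul, norm_mul, hw, one_mul]
  have hone : ‖(b 1 : ℂ)‖ = 1 := by
    have := hmul 1 1
    rw [mul_one] at this
    exact (mul_eq_left₀ (norm_ne_zero_iff.2 (b 1).ne_zero)).1 this.symm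
  -- The modulus is an honest homomorphism, and a non-negative real whose power `Nat.card H` is one
  -- equals one.
  let φ : H →* ℝ := { toFun := fun h => ‖(b h : ℂ)‖, map_one' := hone, map_mul' := hmul }
  have hpow : φ h ^ Nat.card H = 1 := by rw [← map_pow, pow_card_eq_one', map_one]
  exact (pow_eq_one_iff_of_nonneg (norm_nonneg _) Nat.card_pos.ne').1 hpow

end Unbroken

/-! ### On-site operators as matrix product operators -/

section Onsite

variable {d : ℕ}

/-- The matrix product operator tensor, of bond dimension one, of an operator acting on every
site separately. -/
def onsite (U : Matrix (Fin d) (Fin d) ℂ) : Fin d × Fin d → Matrix (Fin 1) (Fin 1) ℂ :=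
  fun p _ _ => U p.1 p.2

theorem mpo_onsite (U : Matrix (Fin d) (Fin d) ℂ) (N : ℕ) (s t : Fin N → Fin d) :
    mpo (onsite U) N s t = ∏ k, U (s k) (t k) := by
  have h : ∀ l : List (Fin d × Fin d), (word (onsite U) l).trace =
      (l.map fun p => U p.1 p.2).prod := fun l => by
    induction l with
    | nil => simp
    | cons p l ih =>
      rw [word_cons, List.map_cons, List.prod_cons, ← ih]
      simp [Matrix.trace, Matrix.mul_apply, onsite]
  simp [mpo, h, List.map_ofFn, List.prod_ofFn]

theorem mpo_onsite_mul (U U' : Matrix (Fin d) (Fin d) ℂ) (N : ℕ) :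
    mpo (onsite U) N * mpo (onsite U') N = mpo (onsite (U * U')) N := by
  ext s t
  simp only [Matrix.mul_apply, mpo_onsite, ← Finset.prod_mul_distrib]
  rw [Finset.prod_univ_sum, Fintype.piFinset_univ]

theorem mpo_onsite_one (N : ℕ) : mpo (onsite (1 : Matrix (Fin d) (Fin d) ℂ)) N = 1 := by
  ext s t
  rw [mpo_onsite]
  by_cases h : s = t
  · subst h
    rw [Matrix.one_apply_eq]
    exact Finset.prod_eq_one fun k _ => Matrix.one_apply_eq _
  · rw [Matrix.one_apply_ne h]
    obtain ⟨k, hk⟩ := Function.ne_iff.1 h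
    exact Finset.prod_eq_zero (Finset.mem_univ k) (Matrix.one_apply_ne hk)

theorem star_mpo_onsite (U : Matrix (Fin d) (Fin d) ℂ) (N : ℕ) :
    star (mpo (onsite U) N) = mpo (onsite (star U)) N := by
  ext s t
  simp [Matrix.star_apply, mpo_onsite]

theorem mpo_onsite_mem_unitaryGroup {U : Matrix (Fin d) (Fin d) ℂ}
    (hU : U ∈ Matrix.unitaryGroup (Fin d) ℂ) (N : ℕ) :
    mpo (onsite U) N ∈ Matrix.unitaryGroup (Fin N → Fin d) ℂ := by
  rw [Matrix.mem_unitaryGroup_iff] at *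
  rw [star_mpo_onsite, mpo_onsite_mul, hU, mpo_onsite_one]

theorem onsite_injective {U : Matrix (Fin d) (Fin d) ℂ} (hU : U ≠ 0) :
    TensorInjective (onsite U) := by
  obtain ⟨i, j, h⟩ : ∃ i j, U i j ≠ 0 := by
    by_contra! h; exact hU (Matrix.ext h)
  refine ⟨fun p _ _ => if p = (i, j) then (U i j)⁻¹ else 0, fun a b a' b' => ?_⟩
  simp [onsite, h, Subsingleton.elim a a', Subsingleton.elim b b']

/-- A conjugation by an invertible matrix is a reduction. -/
theorem isReduction_of_eq {κ m : Type*} [Fintype m] [DecidableEq m] {n : ℕ}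
    {B : κ → Matrix m m ℂ} {A : κ → Matrix (Fin n) (Fin n) ℂ} {P : Matrix (Fin n) m ℂ}
    {Q : Matrix m (Fin n) ℂ} (hB : ∀ i, B i = Q * A i * P) (h : P * Q = 1) (h' : Q * P = 1) :
    IsReduction B A P Q := by
  have hw : ∀ l, word B l = Q * word A l * P := fun l => by
    induction l with
    | nil => simp [h']
    | cons i l ih =>
      rw [word_cons, word_cons, ih, hB]
      calc Q * A i * P * (Q * word A l * P) = Q * A i * (P * Q) * word A l * P := by
            simp only [Matrix.mul_assoc]
        _ = _ := by rw [h, Matrix.mul_one]; simp only [Matrix.mul_assoc]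
  refine ⟨fun l => ?_, fun i k l _ => ?_⟩
  · rw [hw]
    calc P * (Q * word A l * P) * Q = (P * Q) * word A l * (P * Q) := by
          simp only [Matrix.mul_assoc]
      _ = _ := by rw [h, Matrix.mul_one, Matrix.one_mul]
  · rw [hw]
    simp only [Matrix.mul_assoc]

/-- The matrix product operator acts on a matrix product state by acting on its tensor. -/
theorem mpo_mulVec_mps {m n : ℕ} (T : Fin d × Fin d → Matrix (Fin m) (Fin m) ℂ)
    (A : Fin d → Matrix (Fin n) (Fin n) ℂ) (N : ℕ) (s : Fin N → Fin d) :
    (mpo T N).mulVec (mps A N) s = (word (actTensor T A) (List.ofFn s)).trace := by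
  simp only [Matrix.mulVec, dotProduct, word_actTensor_ofFn, Matrix.trace_sum,
    Matrix.trace_kronecker, mpo, mps, Matrix.of_apply]

theorem IsReduction.mpo_mulVec_mps {m n n' : ℕ} {T : Fin d × Fin d → Matrix (Fin m) (Fin m) ℂ}
    {A : Fin d → Matrix (Fin n) (Fin n) ℂ} {A' : Fin d → Matrix (Fin n') (Fin n') ℂ}
    {P : Matrix (Fin n') (Fin m × Fin n) ℂ} {Q : Matrix (Fin m × Fin n) (Fin n') ℂ}
    (h : IsReduction (actTensor T A) A' P Q) (h' : Q * P = 1) (N : ℕ) :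
    (mpo T N).mulVec (mps A N) = mps A' N := by
  ext s
  rw [DomainWall.mpo_mulVec_mps, mps, ← h.1, Matrix.mul_assoc, Matrix.trace_mul_comm,
    Matrix.mul_assoc, h', Matrix.mul_one]

end Onsite

/-! ### Systems built from projective representations of the action groupoid -/

/-- A unitary projective representation of the action groupoid of `G` on `I`. -/
structure ProjRep (G I : Type*) [Group G] [MulAction G I] (n : ℕ) where
  Q : G → I → Matrix (Fin n) (Fin n) ℂ
  c : G → G → I → ℂˣ
  unitary : ∀ g x, Q g x ∈ Matrix.unitaryGroup (Fin n) ℂ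
  one : ∀ x, Q 1 x = 1
  mul : ∀ g h x, Q h x * Q g (h • x) = (c g h x : ℂ) • Q (g * h) x
  norm_c : ∀ g h x, ‖(c g h x : ℂ)‖ = 1

namespace ProjRep

variable {G I : Type*} [Group G] [MulAction G I] {n : ℕ} (ρ : ProjRep G I n)

/-- The inverse matrices. -/
noncomputable def P (g : G) (x : I) : Matrix (Fin n) (Fin n) ℂ := star (ρ.Q g x)

theorem P_mul_Q (g : G) (x : I) : ρ.P g x * ρ.Q g x = 1 :=
  Matrix.mem_unitaryGroup_iff'.1 (ρ.unitary g x)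

theorem Q_mul_P (g : G) (x : I) : ρ.Q g x * ρ.P g x = 1 :=
  Matrix.mem_unitaryGroup_iff.1 (ρ.unitary g x)

/-- A multiplier of modulus one is inverted by conjugation, so `P` carries the phase opposite to
that of `Q`. -/
theorem P_mul (g h : G) (x : I) :
    ρ.P g (h • x) * ρ.P h x = (ρ.c g h x : ℂ)⁻¹ • ρ.P (g * h) x := by
  have h1 : star (ρ.c g h x : ℂ) = (ρ.c g h x : ℂ)⁻¹ :=
    (Complex.inv_eq_conj (ρ.norm_c g h x)).symm
  rw [P, P, ← star_mul, ρ.mul, star_smul, h1]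
  rfl

/-- The spin of the physical sites. -/
abbrev Site (I : Type*) (n : ℕ) := I × Fin n × Fin n

variable [DecidableEq I]

/-- The operator acting on the states of a site. -/
noncomputable def op (g : G) : Matrix (Site I n) (Site I n) ℂ :=
  fun p q => if p.1 = g • q.1 then ρ.Q g q.1 q.2.1 p.2.1 * ρ.P g q.1 p.2.2 q.2.2 else 0

theorem op_one : ρ.op (1 : G) = 1 := by
  ext ⟨x, a, b⟩ ⟨y, a', b'⟩
  simp only [op, P, ρ.one, Matrix.one_apply, Prod.mk.injEq, one_smul, star_one, ite_and]
  split_ifs <;> simp_all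

variable [Fintype I]

/-- Each site contains one factor `Q` and one factor `P`, whose phases cancel. The physical
representation is therefore linear although the virtual one is projective. -/
theorem op_mul (g h : G) : ρ.op g * ρ.op h = ρ.op (g * h) := by
  ext ⟨x, a, b⟩ ⟨y, a', b'⟩
  have h1 := congrFun (congrFun (ρ.mul g h y) a') a
  have h2 := congrFun (congrFun (ρ.P_mul g h y) b) b'
  rw [Matrix.mul_apply] at h1 h2
  simp only [op, Matrix.mul_apply, Fintype.sum_prod_type, mul_ite, ite_mul, mul_zero, zero_mul]
  rw [Finset.sum_eq_single (h • y) (by intro z _ hz; simp [hz]) (by simp)]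
  simp only [if_true, mul_smul]
  split_ifs with hx
  · calc
      _ = (∑ j, ρ.Q h y a' j * ρ.Q g (h • y) j a) *
          ∑ j, ρ.P g (h • y) b j * ρ.P h y j b' := by
        rw [Finset.sum_mul_sum]
        refine Finset.sum_congr rfl fun i _ => Finset.sum_congr rfl fun j _ => ?_
        ring
      _ = _ := by
        rw [h1, h2, Matrix.smul_apply, Matrix.smul_apply, smul_eq_mul, smul_eq_mul]
        have := (ρ.c g h y).ne_zero
        field_simp
  · simp

theorem star_op_mul_op (g : G) : star (ρ.op g) * ρ.op g = 1 := by
  ext ⟨x, a, b⟩ ⟨y, a', b'⟩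
  simp only [op, Matrix.mul_apply, Fintype.sum_prod_type, Matrix.star_apply, mul_ite, mul_zero]
  rw [Finset.sum_eq_single (g • y) (by intro z _ hz; simp [hz]) (by simp)]
  by_cases hxy : x = y
  · subst hxy
    have h1 := congrFun (congrFun (ρ.Q_mul_P g x) a') a
    have h2 := congrFun (congrFun (ρ.Q_mul_P g x) b) b'
    simp only [if_true]
    calc
      _ = (∑ j, ρ.Q g x a' j * ρ.P g x j a) * ∑ j, ρ.Q g x b j * ρ.P g x j b' := by
          rw [Finset.sum_mul_sum]
          refine Finset.sum_congr rfl fun i _ => Finset.sum_congr rfl fun j _ => ?_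
          simp only [P, Matrix.star_apply, star_mul', star_star]
          ring
      _ = _ := by
          rw [← Matrix.mul_apply, ← Matrix.mul_apply, h1, h2]
          simp only [Matrix.one_apply, Prod.mk.injEq, true_and, ite_and,
            eq_comm (a := a') (b := a)]
          split_ifs <;> simp
  · have : g • y ≠ g • x := fun h => hxy (MulAction.injective g h).symm
    simp [this, hxy]

/-- An enumeration of the states of a site. -/
noncomputable def enum (I : Type*) [Fintype I] (n : ℕ) :
    Fin (Fintype.card (Site I n)) ≃ Site I n :=
  (Fintype.equivFin _).symm

/-- The operator acting on a site, with the states enumerated. -/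
noncomputable def siteOp (g : G) :
    Matrix (Fin (Fintype.card (Site I n))) (Fin (Fintype.card (Site I n))) ℂ :=
  (ρ.op g).submatrix (enum I n) (enum I n)

theorem siteOp_one : ρ.siteOp (1 : G) = 1 := by
  rw [siteOp, op_one, Matrix.submatrix_one_equiv]

theorem siteOp_mul (g h : G) : ρ.siteOp g * ρ.siteOp h = ρ.siteOp (g * h) := by
  rw [siteOp, siteOp, Matrix.submatrix_mul_equiv, op_mul, siteOp]

theorem siteOp_mem_unitaryGroup (g : G) :
    ρ.siteOp g ∈ Matrix.unitaryGroup (Fin (Fintype.card (Site I n))) ℂ := by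
  rw [Matrix.mem_unitaryGroup_iff', siteOp, Matrix.star_eq_conjTranspose,
    Matrix.conjTranspose_submatrix, Matrix.submatrix_mul_equiv, ← Matrix.star_eq_conjTranspose,
    star_op_mul_op, Matrix.submatrix_one_equiv]

/-- The tensor of the ground state `x`: maximally entangled pairs of neighbours. -/
noncomputable def tensor (n : ℕ) (x : I) :
    Fin (Fintype.card (Site I n)) → Matrix (Fin n) (Fin n) ℂ :=
  fun i => if (enum I n i).1 = x then
    Matrix.single (enum I n i).2.1 (enum I n i).2.2 1 else 0

theorem tensor_injective (x : I) : TensorInjective (tensor n x) := by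
  refine ⟨fun i a b => if enum I n i = (x, a, b) then 1 else 0, fun a b a' b' => ?_⟩
  rw [← (enum I n).symm.sum_comp]
  simp [tensor, Matrix.single_apply]

theorem overlap_tensor {x y : I} (hxy : x ≠ y) (N : ℕ) :
    overlap (tensor n x) (tensor n y) (N + 1) = 0 := by
  refine Finset.sum_eq_zero fun s _ => ?_
  by_cases h : (enum I n (s 0)).1 = x
  · simp [mps, tensor, h, hxy]
  · simp [mps, tensor, h]

/-- Left action tensors. -/
noncomputable def left (g : G) (x : I) : Matrix (Fin n) (Fin 1 × Fin n) ℂ :=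
  (ρ.P g x).submatrix id Prod.snd

/-- Right action tensors. -/
noncomputable def right (g : G) (x : I) : Matrix (Fin 1 × Fin n) (Fin n) ℂ :=
  (ρ.Q g x).submatrix Prod.snd id

omit [DecidableEq I] [Fintype I] in
theorem left_mul_right (g : G) (x : I) : ρ.left g x * ρ.right g x = 1 := by
  rw [← ρ.P_mul_Q g x]
  ext a b
  simp [left, right, Matrix.mul_apply, Fintype.sum_prod_type]

omit [DecidableEq I] [Fintype I] in
theorem right_mul_left (g : G) (x : I) : ρ.right g x * ρ.left g x = 1 := by
  have h := congrArg (fun X : Matrix (Fin n) (Fin n) ℂ =>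
    X.submatrix (Prod.snd : Fin 1 × Fin n → Fin n) (Prod.snd : Fin 1 × Fin n → Fin n))
    (ρ.Q_mul_P g x)
  rw [Matrix.submatrix_mul _ _ _ id _ Function.bijective_id] at h
  rw [right, left, h]
  ext ⟨i, a⟩ ⟨i', b⟩
  simp [Matrix.one_apply, Prod.ext_iff, Subsingleton.elim i i']

theorem actTensor_tensor (g : G) (x : I) (i : Fin (Fintype.card (Site I n))) :
    actTensor (onsite (ρ.siteOp g)) (tensor n x) i =
      ρ.right g x * tensor n (g • x) i * ρ.left g x := by
  obtain ⟨⟨y, a, b⟩, rfl⟩ := (enum I n).symm.surjective i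
  ext ⟨o, a'⟩ ⟨o', b'⟩
  have h1 : actTensor (onsite (ρ.siteOp g)) (tensor n x) ((enum I n).symm (y, a, b)) (o, a')
      (o', b') = ρ.op g (y, a, b) (x, a', b') := by
    simp only [actTensor, Matrix.sum_apply, Matrix.kronecker_apply]
    -- Of all input states of the site, only the one with label `x` and these virtual indices has a
    -- non-zero tensor entry.
    rw [← (enum I n).symm.sum_comp, Fintype.sum_eq_single (x, a', b')]
    · simp [onsite, siteOp, tensor]
    · rintro ⟨z, c, e⟩ hz
      simp only [tensor, Equiv.apply_symm_apply]
      split_ifs with hzx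
      · rw [Matrix.single_apply_of_ne, mul_zero]
        rintro ⟨rfl, rfl⟩
        exact hz (by rw [hzx])
      · simp
  rw [h1]
  simp only [tensor, Equiv.apply_symm_apply, op]
  split_ifs with hy
  · rw [mul_single_mul_apply]
    rfl
  · simp

theorem isReduction (g : G) (x : I) :
    IsReduction (actTensor (onsite (ρ.siteOp g)) (tensor n x)) (tensor n (g • x))
      (ρ.left g x) (ρ.right g x) :=
  isReduction_of_eq (ρ.actTensor_tensor g x) (ρ.left_mul_right g x) (ρ.right_mul_left g x)

/-- The on-site representation and its ground states. -/
noncomputable def system (hn : 0 < n) (h : MulAction.IsPretransitive G I) [Nonempty I] :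
    System G I where
  d := Fintype.card (Site I n)
  χ _ := 1
  T g := onsite (ρ.siteOp g)
  T_injective g := onsite_injective fun h0 => by
    have h1 := Matrix.mem_unitaryGroup_iff.1 (ρ.siteOp_mem_unitaryGroup g)
    rw [h0, zero_mul] at h1
    have := congrArg (fun X => X ((enum I n).symm (Classical.arbitrary I, ⟨0, hn⟩, ⟨0, hn⟩))
      ((enum I n).symm (Classical.arbitrary I, ⟨0, hn⟩, ⟨0, hn⟩))) h1
    simp at this
  unitary g N _ := mpo_onsite_mem_unitaryGroup (ρ.siteOp_mem_unitaryGroup g) N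
  mpo_one N _ := by rw [siteOp_one, mpo_onsite_one]
  mpo_mul g h N _ := by rw [mpo_onsite_mul, siteOp_mul]
  D _ := n
  A x := tensor n x
  D_pos _ := hn
  A_injective := tensor_injective
  orthogonal x y hxy := by
    refine tendsto_const_nhds.congr' ?_
    filter_upwards [eventually_ge_atTop 1] with N hN
    obtain ⟨N, rfl⟩ := Nat.exists_eq_add_of_le' hN
    simp [overlap_tensor hxy]
  transitive := h
  permutes g x N _ := (ρ.isReduction g x).mpo_mulVec_mps (ρ.right_mul_left g x) N

variable (hn : 0 < n) (h : MulAction.IsPretransitive G I) [Nonempty I]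

/-- The fusion tensors, which are trivial. -/
def fusionRight : FusionRight (ρ.system hn h) :=
  fun _ _ => (Matrix.of fun _ _ => 1 : Matrix (Fin 1 × Fin 1) (Fin 1) ℂ)

def fusionLeft : FusionLeft (ρ.system hn h) :=
  fun _ _ => (Matrix.of fun _ _ => 1 : Matrix (Fin 1) (Fin 1 × Fin 1) ℂ)

noncomputable def actionRight : ActionRight (ρ.system hn h) := fun g x => ρ.right g x

noncomputable def actionLeft : ActionLeft (ρ.system hn h) := fun g x => ρ.left g x

theorem isFusion : IsFusion (ρ.system hn h) (ρ.fusionRight hn h) (ρ.fusionLeft hn h) := by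
  intro g k
  refine isReduction_of_eq (B := compTensor (onsite (ρ.siteOp g)) (onsite (ρ.siteOp k)))
    (A := onsite (ρ.siteOp (g * k))) (P := Matrix.of fun _ _ => 1)
    (Q := Matrix.of fun _ _ => 1) ?_ ?_ ?_
  · rintro ⟨i, j⟩
    ext ⟨a, b⟩ ⟨a', b'⟩
    have := congrFun (congrFun (ρ.siteOp_mul g k) i) j
    rw [Matrix.mul_apply] at this
    simpa [compTensor, Matrix.sum_apply, onsite, Matrix.mul_apply] using this
  · ext a b
    obtain rfl := Subsingleton.elim a b
    simp [Matrix.mul_apply]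
  · ext a b
    obtain rfl := Subsingleton.elim a b
    simp [Matrix.mul_apply]

theorem isAction : IsAction (ρ.system hn h) (ρ.actionRight hn h) (ρ.actionLeft hn h) :=
  fun g x => ρ.isReduction g x

/-- The operator bond dimension is one, so fusing is trivial and the comparison is between `Q (g *
k) x` and the product of two `Q`'s. -/
theorem isLSymbol : IsLSymbol (ρ.system hn h) (ρ.fusionRight hn h) (ρ.actionRight hn h)
    fun g k x => (ρ.c g k x)⁻¹ := by
  intro g k x i j l
  have key : fuseThenAct (ρ.system hn h) (ρ.fusionRight hn h) (ρ.actionRight hn h) g k x =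
      (((ρ.c g k x)⁻¹ : ℂˣ) : ℂ) • actTwice (ρ.system hn h) (ρ.actionRight hn h) g k x := by
    have h1 : fuseThenAct (ρ.system hn h) (ρ.fusionRight hn h) (ρ.actionRight hn h) g k x =
        (ρ.Q (g * k) x).submatrix (fun p : Fin 1 × Fin 1 × Fin n => p.2.2) id := by
      have e : fuseThenAct (ρ.system hn h) (ρ.fusionRight hn h) (ρ.actionRight hn h) g k x =
        (((Matrix.of fun _ _ => 1 : Matrix (Fin 1 × Fin 1) (Fin 1) ℂ) ⊗ₖ
          (1 : Matrix (Fin n) (Fin n) ℂ)).submatrix (Equiv.prodAssoc _ _ _).symm id) *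
            ρ.right (g * k) x := rfl
      rw [e]
      ext ⟨a, a', b⟩ b'
      obtain rfl : a = 0 := Subsingleton.elim _ _
      obtain rfl : a' = 0 := Subsingleton.elim _ _
      simp [right, Matrix.mul_apply, Fintype.sum_prod_type, Matrix.one_apply]
    have h2 : actTwice (ρ.system hn h) (ρ.actionRight hn h) g k x =
        (ρ.Q k x * ρ.Q g (k • x)).submatrix (fun p : Fin 1 × Fin 1 × Fin n => p.2.2) id := by
      have e : actTwice (ρ.system hn h) (ρ.actionRight hn h) g k x =
        ((1 : Matrix (Fin 1) (Fin 1) ℂ) ⊗ₖ ρ.right k x) * ρ.right g (k • x) := rfl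
      rw [e]
      ext ⟨a, a', b⟩ b'
      obtain rfl : a = 0 := Subsingleton.elim _ _
      obtain rfl : a' = 0 := Subsingleton.elim _ _
      simp [right, Matrix.mul_apply, Fintype.sum_prod_type, Matrix.one_apply]
    have h3 : ρ.Q (g * k) x =
        (((ρ.c g k x)⁻¹ : ℂˣ) : ℂ) • (ρ.Q k x * ρ.Q g (k • x)) := by
      rw [ρ.mul, smul_smul, ← Units.val_mul, inv_mul_cancel, Units.val_one, one_smul]
    rw [h1, h2, h3]
    rfl
  simp only [key, Matrix.mul_smul]

end ProjRep

/-! ### Projective action on the space of domain wall tensors -/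

namespace ProjRep

section

variable {G I : Type*} [Group G] [MulAction G I] {n : ℕ} (ρ : ProjRep G I n)
  [DecidableEq I] [Fintype I]

/-- The action of the unbroken symmetry on domain wall tensors. -/
noncomputable def wallAction (y x : I) (h : unbroken G I) :
    Module.End ℂ (Fin (Fintype.card (Site I n)) → Matrix (Fin n) (Fin n) ℂ) where
  toFun e j := ∑ k, ρ.siteOp (h : G) j k • (ρ.P h y * e k * ρ.Q h x)
  map_add' e e' := by
    ext1 j
    simp [Matrix.mul_add, Matrix.add_mul, Finset.sum_add_distrib]
  map_smul' c e := by
    ext1 j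
    simp [Finset.smul_sum, smul_comm c]

theorem wallAction_apply (y x : I) (h : unbroken G I)
    (e : Fin (Fintype.card (Site I n)) → Matrix (Fin n) (Fin n) ℂ)
    (j : Fin (Fintype.card (Site I n))) :
    ρ.wallAction y x h e j = ρ.left h y * actTensor (onsite (ρ.siteOp (h : G))) e j *
      ρ.right h x := by
  ext a b
  simp only [wallAction, LinearMap.coe_mk, AddHom.coe_mk, actTensor, Matrix.sum_apply,
    Matrix.mul_sum, Matrix.sum_mul]
  refine Finset.sum_congr rfl fun k _ => ?_
  simp only [Matrix.smul_apply, Matrix.mul_apply, Fintype.sum_prod_type, left, right, onsite,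
    Matrix.submatrix_apply, Matrix.kronecker_apply, Fin.sum_univ_one, id, smul_eq_mul,
    Finset.mul_sum, Finset.sum_mul]
  refine Finset.sum_congr rfl fun i _ => Finset.sum_congr rfl fun j _ => ?_
  ring

theorem isWallAction (hn : 0 < n) (h : MulAction.IsPretransitive G I) [Nonempty I] (y x : I) :
    IsWallAction (ρ.system hn h) (ρ.actionRight hn h) (ρ.actionLeft hn h) y x
      (ρ.wallAction y x) := by
  intro g e i j k
  -- All bond dimensions equal `n`, so the casts in `IsWallAction` are definitionally trivial and
  -- `key` is the goal.
  have key (e : Fin (Fintype.card (Site I n)) → Matrix (Fin n) (Fin n) ℂ)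
      (i j k : Fin (Fintype.card (Site I n))) :
      ρ.left g y * actTensor (onsite (ρ.siteOp (g : G))) (tensor n y) i *
      actTensor (onsite (ρ.siteOp (g : G))) e j *
      actTensor (onsite (ρ.siteOp (g : G))) (tensor n x) k * ρ.right g x =
      tensor n ((g : G) • y) i * ρ.wallAction y x g e j * tensor n ((g : G) • x) k := by
    rw [wallAction_apply, actTensor_tensor, actTensor_tensor]
    calc _ = (ρ.left g y * ρ.right g y) * tensor n ((g : G) • y) i *
          (ρ.left g y * actTensor (onsite (ρ.siteOp (g : G))) e j * ρ.right g x) *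
            tensor n ((g : G) • x) k * (ρ.left g x * ρ.right g x) := by
          simp only [Matrix.mul_assoc]
      _ = _ := by rw [left_mul_right, left_mul_right, Matrix.one_mul, Matrix.mul_one]
  exact key e i j k

/-- The `P`'s at `y` contribute the inverse multiplier, the `Q`'s at `x` the multiplier itself, and
the site operators no phase. -/
theorem wallAction_mul (y x : I) (h₁ h₂ : unbroken G I) :
    ρ.wallAction y x h₁ * ρ.wallAction y x h₂ =
      (wallFactor (fun g k z => (ρ.c g k z)⁻¹) y x h₁ h₂ : ℂ) • ρ.wallAction y x (h₁ * h₂) := by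
  refine LinearMap.ext fun e => funext fun j => ?_
  have hP := ρ.P_mul (h₁ : G) h₂ y
  have hQ := ρ.mul (h₁ : G) h₂ x
  rw [smul_eq_of_unbroken] at hP hQ
  have hm : ∀ X : Matrix (Fin n) (Fin n) ℂ, ρ.P h₁ y * (ρ.P h₂ y * X * ρ.Q h₂ x) * ρ.Q h₁ x =
      (wallFactor (fun g k z => (ρ.c g k z)⁻¹) y x h₁ h₂ : ℂ) •
        (ρ.P (h₁ * h₂ : G) y * X * ρ.Q (h₁ * h₂ : G) x) := fun X => by
    calc _ = (ρ.P h₁ y * ρ.P h₂ y) * X * (ρ.Q h₂ x * ρ.Q h₁ x) := by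
          simp only [Matrix.mul_assoc]
      _ = _ := by
          rw [hP, hQ, Matrix.smul_mul, Matrix.smul_mul, Matrix.mul_smul, smul_smul]
          congr 1
          simp [wallFactor]
  simp only [Module.End.mul_apply, LinearMap.smul_apply, Pi.smul_apply, wallAction,
    LinearMap.coe_mk, AddHom.coe_mk, Matrix.mul_sum, Matrix.sum_mul, Finset.smul_sum,
    Matrix.mul_smul, Matrix.smul_mul, hm, Subgroup.coe_mul]
  rw [Finset.sum_comm]
  refine Finset.sum_congr rfl fun k _ => ?_
  rw [← ρ.siteOp_mul, Matrix.mul_apply, Finset.sum_smul, Finset.smul_sum]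
  refine Finset.sum_congr rfl fun l _ => ?_
  rw [smul_smul, smul_smul, smul_smul, mul_comm]

end

end ProjRep

/-! ### The Klein wreath product and its non-trivial cocycle -/

section Pauli

/-- The Klein four-group. -/
abbrev Klein := Multiplicative (ZMod 2 × ZMod 2)

/-- The Pauli matrices `1`, `X`, `Z`, `X Z`. -/
def pauliInt (k : Klein) : Matrix (Fin 2) (Fin 2) ℤ :=
  (if k.toAdd.1 = 0 then 1 else !![0, 1; 1, 0]) * if k.toAdd.2 = 0 then 1 else !![1, 0; 0, -1]

/-- The cocycle of the Pauli matrices. -/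
def pauliSign (k l : Klein) : ℤˣ :=
  if k.toAdd.2 = 0 ∨ l.toAdd.1 = 0 then 1 else -1

/-- A sign arises exactly when a `Z` is moved past an `X`. Integer entries make this decidable; the
order `l * k` is the one in `ProjRep.mul`. -/
theorem pauliInt_mul : ∀ k l, pauliInt k * pauliInt l =
    (pauliSign k l : ℤ) • pauliInt (l * k) := by
  decide

theorem pauliInt_mul_transpose : ∀ k, pauliInt k * (pauliInt k).transpose = 1 := by
  decide

noncomputable def pauli (k : Klein) : Matrix (Fin 2) (Fin 2) ℂ :=
  (pauliInt k).map (Int.castRingHom ℂ)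

theorem pauli_mem_unitaryGroup (k : Klein) : pauli k ∈ Matrix.unitaryGroup (Fin 2) ℂ := by
  have h : star (pauli k) = ((pauliInt k).transpose).map (Int.castRingHom ℂ) := by
    ext i j
    simp [pauli, Matrix.star_apply]
  rw [Matrix.mem_unitaryGroup_iff, h, pauli, ← Matrix.map_mul, pauliInt_mul_transpose]
  simp

theorem pauli_mul (k l : Klein) :
    pauli k * pauli l = ((pauliSign k l : ℤ) : ℂ) • pauli (l * k) := by
  rw [pauli, pauli, ← Matrix.map_mul, pauliInt_mul]
  ext i j
  simp only [pauli, Matrix.map_apply, Matrix.smul_apply, smul_eq_mul, eq_intCast, Int.cast_mul]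

/-- Two copies of the Klein four-group and their exchange. -/
abbrev KleinWreath := RegularWreathProduct Klein (Multiplicative (ZMod 2))

/-- The exchange permutes two ground states. -/
instance : MulAction KleinWreath (Multiplicative (ZMod 2)) where
  smul g x := g.right * x
  one_smul x := one_mul x
  mul_smul g h x := mul_assoc g.right h.right x

theorem kleinWreath_smul (g : KleinWreath) (x : Multiplicative (ZMod 2)) :
    g • x = g.right * x := rfl

/-- Each of the two copies of the Klein four-group acts projectively on one of the ground
states. -/
noncomputable def kleinRep : ProjRep KleinWreath (Multiplicative (ZMod 2)) 2 where
  -- The component is read off at the target label: in the wreath product, `(g * h).left` at `g • h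
  -- • x` is `g.left (g • h • x) * h.left (h • x)`.
  Q g x := pauli (g.left (g • x))
  c g h x := Units.map (Int.castRingHom ℂ).toMonoidHom
    (pauliSign (h.left (h • x)) (g.left (g • h • x)))
  unitary g x := pauli_mem_unitaryGroup _
  one x := by
    have : pauliInt 1 = 1 := by decide
    simp [pauli, this]
  mul g h x := by
    rw [pauli_mul]
    simp [kleinWreath_smul, mul_assoc]
  norm_c g h x := by
    rcases Int.units_eq_one_or (pauliSign (h.left (h • x)) (g.left (g • h • x))) with h | h <;>
      simp [h]

theorem kleinWreath_isPretransitive :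
    MulAction.IsPretransitive KleinWreath (Multiplicative (ZMod 2)) :=
  ⟨fun x y => ⟨⟨1, y * x⁻¹⟩, by simp [kleinWreath_smul]⟩⟩

/-- Elements of the unbroken subgroup which act on one of the ground states only. -/
def kleinLift (k : Klein) : unbroken KleinWreath (Multiplicative (ZMod 2)) :=
  ⟨⟨Pi.mulSingle 1 k, 1⟩, fun x => by
    rw [kleinWreath_smul]
    exact one_mul _⟩

/-- A coboundary is symmetric on commuting pairs because `ℂˣ` is commutative. -/
theorem not_isTwoCoboundary_of_ne {H : Type*} [Group H] {f : H → H → ℂˣ} {h₁ h₂ : H}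
    (hc : h₁ * h₂ = h₂ * h₁) (hf : f h₁ h₂ ≠ f h₂ h₁) : ¬ IsTwoCoboundary f := by
  rintro ⟨c, h⟩
  exact hf (by rw [h, h, hc, mul_comm (c h₁)])

/-- The lifted elements are trivial at the second ground state, so only the Pauli sign at the first
one survives. -/
theorem kleinRep_wallFactor (k l : Klein) :
    wallFactor (fun g h z => (kleinRep.c g h z)⁻¹) 1 (Multiplicative.ofAdd 1) (kleinLift k)
      (kleinLift l) = Units.map (Int.castRingHom ℂ).toMonoidHom (pauliSign l k) := by
  have h1 : pauliSign 1 1 = 1 := by decide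
  have h2 : (Multiplicative.ofAdd (1 : ZMod 2)) ≠ 1 := by decide
  have h3 : (pauliSign l k)⁻¹ = pauliSign l k := Int.units_inv_eq_self _
  simp only [wallFactor, kleinRep, smul_eq_of_unbroken]
  simp only [kleinLift, Pi.mulSingle_eq_same, Pi.mulSingle_eq_of_ne h2, h1, map_one, inv_one,
    div_one]
  rw [← map_inv, h3]

theorem not_isTwoCoboundary_kleinRep :
    ¬ IsTwoCoboundary (wallFactor (fun g h z => (kleinRep.c g h z)⁻¹) 1
      (Multiplicative.ofAdd 1)) := by
  -- The lifts of `X` and `Z` commute in the group, while the Pauli matrices anticommute.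
  refine not_isTwoCoboundary_of_ne (h₁ := kleinLift (Multiplicative.ofAdd (1, 0)))
    (h₂ := kleinLift (Multiplicative.ofAdd (0, 1))) ?_ ?_
  · ext1
    ext1
    · funext x
      simp [kleinLift, mul_comm]
    · rfl
  · rw [kleinRep_wallFactor, kleinRep_wallFactor]
    have h1 : pauliSign (Multiplicative.ofAdd (0, 1)) (Multiplicative.ofAdd (1, 0)) = -1 := by
      decide
    have h2 : pauliSign (Multiplicative.ofAdd (1, 0)) (Multiplicative.ofAdd (0, 1)) = 1 := by
      decide
    rw [h1, h2, Ne, Units.ext_iff]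
    simp
    norm_num

end Pauli

end DomainWall

/-! ### The main theorem -/

theorem mainTheorem5 :
    (∀ (G I : Type*) [Group G] [Finite G] [MulAction G I] (S : DomainWall.System G I)
      (V : DomainWall.FusionRight S) (Vhat : DomainWall.FusionLeft S)
      (W : DomainWall.ActionRight S) (What : DomainWall.ActionLeft S),
      DomainWall.IsFusion S V Vhat → DomainWall.IsAction S W What →
      -- the L-symbols are well defined
      (∃! L : G → G → I → ℂˣ, DomainWall.IsLSymbol S V W L) ∧
      ∀ L : G → G → I → ℂˣ, DomainWall.IsLSymbol S V W L →
        -- the factor is a two-cocycle on the unbroken subgroup, for every pair of labels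
        (∀ y x : I, DomainWall.IsTwoCocycle (DomainWall.wallFactor L y x)) ∧
        -- the B-phases are well defined and compose with this factor;
        -- local excitations transform linearly
        (∀ e : DomainWall.WallTensors S, DomainWall.ArePermutedWalls S e →
          (∃! B : G → I → I → ℂˣ, DomainWall.IsWallPhase S W What e B) ∧
          ∀ B : G → I → I → ℂˣ, DomainWall.IsWallPhase S W What e B →
            (∀ (y x : I) (h₁ h₂ : DomainWall.unbroken G I),
              B h₁ y x * B h₂ y x =
                DomainWall.wallFactor L y x h₁ h₂ * B (h₁ * h₂ : G) y x) ∧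
            (∀ (x : I) (h₁ h₂ : DomainWall.unbroken G I),
              B h₁ x x * B h₂ x x = B (h₁ * h₂ : G) x x) ∧
            ((∀ g h x, ‖(L g h x : ℂ)‖ = 1) →
              ∀ (y x : I) (h : DomainWall.unbroken G I), ‖(B h y x : ℂ)‖ = 1)) ∧
        -- the freedom in the fusion and action tensors
        (∀ (β : G → G → ℂˣ) (γ : G → I → ℂˣ),
          DomainWall.IsFusion S (fun g h => (β g h : ℂ) • V g h)
            (fun g h => (β g h : ℂ)⁻¹ • Vhat g h) ∧
          DomainWall.IsAction S (fun g x => (γ g x : ℂ) • W g x)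
            (fun g x => (γ g x : ℂ)⁻¹ • What g x) ∧
          ∀ L' : G → G → I → ℂˣ,
            DomainWall.IsLSymbol S (fun g h => (β g h : ℂ) • V g h)
              (fun g x => (γ g x : ℂ) • W g x) L' →
            ∀ (y x : I) (h₁ h₂ : DomainWall.unbroken G I),
              DomainWall.wallFactor L y x h₁ h₂ =
                DomainWall.wallFactor L' y x h₁ h₂ *
                  ((γ h₁ y / γ h₁ x) * (γ h₂ y / γ h₂ x) /
                    (γ (h₁ * h₂ : G) y / γ (h₁ * h₂ : G) x))) ∧
        -- the tensors can be rescaled so that all L-symbols are phases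
        (∃ (β : G → G → ℂˣ) (γ : G → I → ℂˣ) (L' : G → G → I → ℂˣ),
          DomainWall.IsLSymbol S (fun g h => (β g h : ℂ) • V g h)
            (fun g x => (γ g x : ℂ) • W g x) L' ∧
          ∀ g h x, ‖(L' g h x : ℂ)‖ = 1)) ∧
    -- the action on domain walls can be genuinely projective: the unbroken symmetry can act on the
    -- domain wall tensors between two ground states with a cohomologically non-trivial factor
    (∃ (G I : Type) (_ : Group G) (_ : Finite G) (_ : MulAction G I) (S : DomainWall.System G I)
      (V : DomainWall.FusionRight S) (Vhat : DomainWall.FusionLeft S)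
      (W : DomainWall.ActionRight S) (What : DomainWall.ActionLeft S) (L : G → G → I → ℂˣ)
      (y x : I)
      (R : DomainWall.unbroken G I →
        Module.End ℂ (Fin S.d → Matrix (Fin (S.D y)) (Fin (S.D x)) ℂ)),
      DomainWall.IsFusion S V Vhat ∧ DomainWall.IsAction S W What ∧
      DomainWall.IsLSymbol S V W L ∧ (∀ g h z, ‖(L g h z : ℂ)‖ = 1) ∧
      DomainWall.IsWallAction S W What y x R ∧
      (∀ h₁ h₂ : DomainWall.unbroken G I,
        R h₁ * R h₂ = (DomainWall.wallFactor L y x h₁ h₂ : ℂ) • R (h₁ * h₂)) ∧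
      ¬ DomainWall.IsTwoCoboundary (DomainWall.wallFactor L y x)) := by 
  refine ⟨?_, ?_⟩
  · intro G I _ _ _ S V Vhat W What hV hW
    obtain ⟨L₀, hL₀⟩ := DomainWall.exists_isLSymbol hV hW
    refine ⟨⟨L₀, hL₀, fun L hL => hL.unique hW hL₀⟩, fun L hL =>
      ⟨hL.isTwoCocycle hV hW, fun e he => ⟨he.existsUnique_isWallPhase hW, fun B hB => ?_⟩,
        fun β γ => ⟨hV.smul β, hW.smul γ, fun L' hL' => hL.wallFactor_smul hW hL'⟩,
        hL.exists_norm_eq_one hV hW⟩⟩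
    have hmul := hB.mul_unbroken hV hW hL he.1
    refine ⟨hmul, fun x h₁ h₂ => ?_, fun hn y x h => ?_⟩
    · rw [hmul, DomainWall.wallFactor, div_self', one_mul]
    · exact DomainWall.norm_eq_one_of_projective
        (b := fun h : DomainWall.unbroken G I => B h y x)
        (DomainWall.norm_wallFactor hn y x) (hmul y x) h
  · have ht := DomainWall.kleinWreath_isPretransitive
    refine ⟨DomainWall.KleinWreath, Multiplicative (ZMod 2), inferInstance, inferInstance,
      inferInstance, DomainWall.kleinRep.system two_pos ht,
      DomainWall.kleinRep.fusionRight two_pos ht, DomainWall.kleinRep.fusionLeft two_pos ht,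
      DomainWall.kleinRep.actionRight two_pos ht, DomainWall.kleinRep.actionLeft two_pos ht,
      fun g h z => (DomainWall.kleinRep.c g h z)⁻¹, 1, Multiplicative.ofAdd 1,
      DomainWall.kleinRep.wallAction 1 (Multiplicative.ofAdd 1),
      DomainWall.kleinRep.isFusion two_pos ht, DomainWall.kleinRep.isAction two_pos ht,
      DomainWall.kleinRep.isLSymbol two_pos ht, fun g h z => ?_,
      DomainWall.kleinRep.isWallAction two_pos ht _ _, DomainWall.kleinRep.wallAction_mul _ _,
      DomainWall.not_isTwoCoboundary_kleinRep⟩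
    rw [Units.val_inv_eq_inv_val, norm_inv, DomainWall.kleinRep.norm_c, inv_one]
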